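/- **Setting.** Let $m\ge 2$ agents be connected by an undirected connected graph $G$ on $\{1,\dots,m\}$. Agent $i$ holds a differentiable function $f_i:\mathbb R^d\to\mathbb R$ that is $\mu$-strongly convex and $L$-smooth, $\mu>0$, i.e. $\frac{\mu}{2}\|y-x\|^2\le f_i(y)-f_i(x)-\langle\nabla f_i(x),y-x\rangle\le\frac{L}{2}\|y-x\|^2$ for all $x,y$. Let $B\in\mathbb R^{p\times d}$, $B\neq 0$, $\ker B\ne\{0\}$, and let $W\in\mathbb R^{m\times m}$ be symmetric positive semi-definite with $W_{ij}=0$ whenever $i\ne j$ are not adjacent and $\ker W=\mathrm{span}\{\mathbf 1\}$. Put $\mathbf W=W\otimes I_d$, $\mathbf B=I_m\otimes B$, $F(\mathbf x)=\sum_i f_i(x_i)$ for $\mathbf x=(x_1,\dots,x_m)\in\mathbb R^{md}$, and let $\mathbf x^*$ solve $\min F(\mathbf x)$ subject to $\mathbf W\mathbf x=0$, $\mathbf B\mathbf x=0$. For a nonzero symmetric positive semi-definite $M$ let $\chi(M)=\lambda_{\max}(M)/\lambda_{\min}^+(M)$, where $\lambda_{\min}^+$ is the least nonzero eigenvalue.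 One *gradient call* evaluates every $\nabla f_i$ once at the current block of node $i$; one *communication* is a multiplication by $\mathbf W$; multiplications by $\mathbf B$, $\mathbf B^\top$ are counted as one multiplication by $B$, $B^\top$ at each node. **APDG** for $\min_{\mathbf x}\max_{\mathbf y}F(\mathbf x)+\langle\mathbf y,\mathbf A\mathbf x\rangle$, with $\mathbf x^0\in\mathrm{range}\,\mathbf A^\top$, $\mathbf y^0\in\mathrm{range}\,\mathbf A$, parameters $\eta_x,\eta_y,\alpha_x,\beta_x,\beta_y>0$, $\tau_x,\tau_y,\sigma_x,\sigma_y\in(0,1]$, $\theta\in(0,1)$, starts from $\mathbf x_f^0=\mathbf x^0$, $\mathbf y_f^0=\mathbf y^{-1}=\mathbf y^0$ and iterates $$\begin{aligned} \mathbf y_m^k&=\mathbf y^k+\theta(\mathbf y^k-\mathbf y^{k-1}),\quad \mathbf x_g^k=\tau_x\mathbf x^k+(1-\tau_x)\mathbf x_f^k,\quad \mathbf y_g^k=\tau_y\mathbf y^k+(1-\tau_y)\mathbf y_f^k,\\ \mathbf x^{k+1}&=\mathbf x^k+\eta_x\alpha_x(\mathbf x_g^k-\mathbf x^k)-\eta_x\beta_x\mathbf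 A^\top\mathbf A\mathbf x^k-\eta_x(\nabla F(\mathbf x_g^k)+\mathbf A^\top\mathbf y_m^k),\\ \mathbf y^{k+1}&=\mathbf y^k-\eta_y\beta_y\mathbf A(\mathbf A^\top\mathbf y^k+\nabla F(\mathbf x_g^k))+\eta_y\mathbf A\mathbf x^{k+1},\\ \mathbf x_f^{k+1}&=\mathbf x_g^k+\sigma_x(\mathbf x^{k+1}-\mathbf x^k),\quad \mathbf y_f^{k+1}=\mathbf y_g^k+\sigma_y(\mathbf y^{k+1}-\mathbf y^k). \end{aligned}$$ **Chebyshev polynomials.** For $M$ as above with $l=\lambda_{\min}^+(M)$, $u=\lambda_{\max}(M)$, $K=\lfloor\sqrt{\chi(M)}\rfloor$ let $P_M(t)=1-T_K\!\left(\frac{u+l-2t}{u-l}\right)/\,T_K\!\left(\frac{u+l}{u-l}\right)$, and $P_M(t)=t/u$ if $l=u$, where $T_K$ is the Chebyshev polynomial of the first kind. **Theorem.** There are an absolute constant $C>0$ and a rule that computes admissible parameters of APDG from $\mu$, $L$, $\lambda_{\min}^+(\mathbf A^\top\mathbf A)$, $\lambda_{\max}(\mathbf A^\top\mathbf A)$ alone,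 such that for every problem as above the following hold. 1. *(Optimal $\gamma$.)* For $\mathbf A_\gamma=\begin{pmatrix}\mathbf B\\ \gamma\mathbf W\end{pmatrix}$, the minimum of $\chi(\mathbf A_\gamma^\top\mathbf A_\gamma)$ over $\gamma>0$ is attained at $\gamma=\sqrt{\lambda_{\min}^+(B^\top B)}/\lambda_{\min}^+(W)$ and equals $\chi:=\chi(W)^2+\chi(B^\top B)$. Write $\mathbf A$ for $\mathbf A_\gamma$ at this $\gamma$. 2. *(APDG.)* Run APDG with $\mathbf A$ from any admissible $\mathbf x^0,\mathbf y^0$; put $\mathbf p^0=\mathbf A^\top\mathbf y^0$, $\kappa=\max\{\sqrt{\chi}\sqrt{L/\mu},\,\chi\}$ and $$D=C\,\frac L\mu\Big(\|\mathbf x^0-\mathbf x^*\|+\frac{\|\mathbf p^0\|+\|\nabla F(\mathbf x^*)\|}{\mu}\Big).$$ The first $N$ iterations use exactly $N$ gradient calls and at most $CN$ communications. For every $\varepsilon>0$: $\|\mathbf x^N-\mathbf x^*\|\le\varepsilon$ for all $N\ge C\kappa\log(D/\varepsilon)$; $|F(\mathbf x^N)-F(\mathbf x^*)|\le\varepsilon$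 for all $N\ge C\kappa\log(LD^2/\varepsilon)$; $\|\mathbf A\mathbf x^N\|\le\varepsilon$ for all $N\ge C\kappa\log(\sqrt{\lambda_{\max}(\mathbf A^\top\mathbf A)}\,D/\varepsilon)$ (with the convention $\log 0=0$ if $D=0$). So $\varepsilon$-accuracy takes $O\big(\max\{\sqrt{\chi(W)^2+\chi(B^\top B)}\sqrt{L/\mu},\ \chi(W)^2+\chi(B^\top B)\}\log\frac1\varepsilon\big)$ gradient calls and communications, up to the dependence of the logarithm on the problem data and the starting point. 3. *(Chebyshev acceleration.)* The polynomials $P_W$ and $P_{B^\top B}$ have degrees at most $C\sqrt{\chi(W)}$ and $C\sqrt{\chi(B^\top B)}$, and $\chi(P_W(W))\le C$, $\chi(P_{B^\top B}(B^\top B))\le C$. Replace $W$ by $P_W(W)$, $B^\top B$ by $P_{B^\top B}(B^\top B)$, and $\gamma$ by the value that is optimal for these matrices, and run APDG in the variables $\mathbf p=\mathbf A^\top\mathbf y$ (in which it uses $\mathbf A$ only through $\mathbf A^\top\mathbf A$) from any $\mathbf x^0,\mathbf p^0\in\mathrm{range}\,\mathbf A^\top$, evaluating the polynomials by Horner's rule.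 Its iterates $\mathbf x^k$ are those of APDG for the matrix $\begin{pmatrix}I_m\otimes B'\\ \gamma P_W(W)\otimes I_d\end{pmatrix}$, for some $B'$ with $B'^\top B'=P_{B^\top B}(B^\top B)$, from admissible starting points. The first $N$ iterations use exactly $N$ gradient calls, at most $CN\sqrt{\chi(W)}$ communications and at most $CN\sqrt{\chi(B^\top B)}$ multiplications by $B$, $B^\top$ at each node, and the three accuracy estimates of part 2 (with the same $D$ and the original $\mathbf A$) hold with $\kappa=\sqrt{L/\mu}$. So $N=O(\sqrt{L/\mu}\,\log\frac1\varepsilon)$ gradient calls per node, $O(N\sqrt{\chi(W)})$ communications and $O(N\sqrt{\chi(B^\top B)})$ multiplications by $B$, $B^\top$ give $\varepsilon$-accuracy. -/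

import Mathlib

open scoped Matrix Kronecker

noncomputable section

namespace DecOpt

/-! ### Spectral quantities of symmetric positive semi-definite matrices -/

/-- The largest eigenvalue `λ_max(M)`. -/
def lamMax {ι : Type} [Fintype ι] [DecidableEq ι] (M : Matrix ι ι ℝ) : ℝ :=
  sSup (spectrum ℝ M)

/-- The smallest nonzero eigenvalue `λ_min⁺(M)` (of a nonzero positive semi-definite `M`). -/
def lamMinPos {ι : Type} [Fintype ι] [DecidableEq ι] (M : Matrix ι ι ℝ) : ℝ :=
  sInf (spectrum ℝ M \ {0})

/-- The condition number `χ(M) = λ_max(M) / λ_min⁺(M)`. -/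
def condNum {ι : Type} [Fintype ι] [DecidableEq ι] (M : Matrix ι ι ℝ) : ℝ :=
  lamMax M / lamMinPos M

/-! ### The decentralized problem -/

/-- The stacked space `(ℝ^q)^m` with its Euclidean norm; node `i` holds the block `(i, ·)`. -/
abbrev Stack (m q : ℕ) : Type := EuclideanSpace ℝ (Fin m × Fin q)

/-- The space of the multipliers `(u, v)`, `u ∈ (ℝ^q)^m`, `v ∈ (ℝ^d)^m`. -/
abbrev Mult (m q d : ℕ) : Type := EuclideanSpace ℝ ((Fin m × Fin q) ⊕ (Fin m × Fin d))

/-- The block held by node `i`. -/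
def block {m q : ℕ} (x : Stack m q) (i : Fin m) : EuclideanSpace ℝ (Fin q) :=
  WithLp.toLp 2 fun j => x (i, j)

/-- `f` is differentiable, `μ`-strongly convex and `L`-smooth. -/
structure StronglyConvexSmooth {d : ℕ} (μ L : ℝ) (f : EuclideanSpace ℝ (Fin d) → ℝ) : Prop where
  differentiable : Differentiable ℝ f
  lower : ∀ x y, f x + inner ℝ (gradient f x) (y - x) + μ / 2 * ‖y - x‖ ^ 2 ≤ f y
  upper : ∀ x y, f y ≤ f x + inner ℝ (gradient f x) (y - x) + L / 2 * ‖y - x‖ ^ 2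

/-- The assumptions on the matrix that represents the communication network. -/
structure IsMixingMatrix {m : ℕ} (G : SimpleGraph (Fin m)) (W : Matrix (Fin m) (Fin m) ℝ) :
    Prop where
  posSemidef : W.PosSemidef
  compatible : ∀ i j, i ≠ j → ¬ G.Adj i j → W i j = 0
  kernel : ∀ v : Fin m → ℝ, W *ᵥ v = 0 ↔ ∀ i j, v i = v j

/-- The data of `min ∑ i, f i x` subject to `B x = 0`, distributed over a network of `m` agents. -/
structure Problem (m d p : ℕ) where
  /-- the communication graph -/
  G : SimpleGraph (Fin m)
  /-- the mixing matrix -/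
  W : Matrix (Fin m) (Fin m) ℝ
  /-- the affine constraints -/
  B : Matrix (Fin p) (Fin d) ℝ
  /-- the local objectives -/
  f : Fin m → EuclideanSpace ℝ (Fin d) → ℝ
  /-- the strong convexity constant -/
  μ : ℝ
  /-- the smoothness constant -/
  L : ℝ

/-- The standing assumptions. `two_le` and `B_ne_zero` say that `W` and `BᵀB` have a nonzero
eigenvalue, i.e. that the condition numbers `χ(W)` and `χ(BᵀB)` make sense. -/
structure Problem.Valid {m d p : ℕ} (P : Problem m d p) : Prop where
  two_le : 2 ≤ m
  connected : P.G.Connected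
  mixing : IsMixingMatrix P.G P.W
  B_ne_zero : P.B ≠ 0
  ker_B : ∃ x : Fin d → ℝ, x ≠ 0 ∧ P.B *ᵥ x = 0
  mu_pos : 0 < P.μ
  objective : ∀ i, StronglyConvexSmooth P.μ P.L (P.f i)

/-- `𝐖 = W ⊗ I_d`. -/
def bigW {m : ℕ} (d : ℕ) (W : Matrix (Fin m) (Fin m) ℝ) :
    Matrix (Fin m × Fin d) (Fin m × Fin d) ℝ :=
  W ⊗ₖ (1 : Matrix (Fin d) (Fin d) ℝ)

/-- `𝐁 = I_m ⊗ B`. -/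
def bigB {q d : ℕ} (m : ℕ) (B : Matrix (Fin q) (Fin d) ℝ) :
    Matrix (Fin m × Fin q) (Fin m × Fin d) ℝ :=
  (1 : Matrix (Fin m) (Fin m) ℝ) ⊗ₖ B

/-- `𝐀 = [𝐁; γ𝐖]`. -/
def conMat {m q d : ℕ} (B : Matrix (Fin q) (Fin d) ℝ) (W : Matrix (Fin m) (Fin m) ℝ) (γ : ℝ) :
    Matrix ((Fin m × Fin q) ⊕ (Fin m × Fin d)) (Fin m × Fin d) ℝ :=
  Matrix.fromRows (bigB m B) (γ • bigW d W)

/-- `γ = √(λ_min⁺(Q)) / λ_min⁺(W)`, to be used with `Q = BᵀB`. -/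
def gammaOpt {m d : ℕ} (Q : Matrix (Fin d) (Fin d) ℝ) (W : Matrix (Fin m) (Fin m) ℝ) : ℝ :=
  √(lamMinPos Q) / lamMinPos W

/-- `F(𝐱) = ∑ i, f i (x_i)`. -/
def Problem.F {m d p : ℕ} (P : Problem m d p) (x : Stack m d) : ℝ :=
  ∑ i, P.f i (block x i)

/-- `∇F(𝐱) = col(∇f_1(x_1), …, ∇f_m(x_m))`. -/
def Problem.gradF {m d p : ℕ} (P : Problem m d p) (x : Stack m d) : Stack m d :=
  WithLp.toLp 2 fun ij => gradient (P.f ij.1) (block x ij.1) ij.2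

/-- `𝐱` satisfies `𝐖𝐱 = 0` and `𝐁𝐱 = 0`. -/
def Problem.Feasible {m d p : ℕ} (P : Problem m d p) (x : Stack m d) : Prop :=
  (bigW d P.W).toEuclideanLin x = 0 ∧ (bigB m P.B).toEuclideanLin x = 0

/-- `𝐱` solves `min F(𝐱)` subject to `𝐖𝐱 = 0`, `𝐁𝐱 = 0`. -/
def Problem.IsSolution {m d p : ℕ} (P : Problem m d p) (x : Stack m d) : Prop :=
  P.Feasible x ∧ ∀ z, P.Feasible z → P.F x ≤ P.F z

/-- The matrix `𝐀` of the problem at the optimal `γ`. -/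
def Problem.A {m d p : ℕ} (P : Problem m d p) :
    Matrix ((Fin m × Fin p) ⊕ (Fin m × Fin d)) (Fin m × Fin d) ℝ :=
  conMat P.B P.W (gammaOpt (P.Bᵀ * P.B) P.W)

/-! ### APDG for `min_x max_y F(x) + ⟨y, A x⟩` -/

/-- The parameters of APDG. -/
structure APDGParams where
  ηx : ℝ
  ηy : ℝ
  αx : ℝ
  βx : ℝ
  βy : ℝ
  τx : ℝ
  τy : ℝ
  σx : ℝ
  σy : ℝ
  θ : ℝ

/-- The admissible parameters of APDG. -/
def APDGParams.Valid (c : APDGParams) : Prop :=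
  0 < c.ηx ∧ 0 < c.ηy ∧ 0 < c.αx ∧ 0 < c.βx ∧ 0 < c.βy ∧
    c.τx ∈ Set.Ioc (0 : ℝ) 1 ∧ c.τy ∈ Set.Ioc (0 : ℝ) 1 ∧
    c.σx ∈ Set.Ioc (0 : ℝ) 1 ∧ c.σy ∈ Set.Ioc (0 : ℝ) 1 ∧ c.θ ∈ Set.Ioo (0 : ℝ) 1

/-- The variables `x^k, x_f^k, y^k, y^{k-1}, y_f^k`. -/
structure APDGState (E F : Type) where
  x : E
  xf : E
  y : F
  yPrev : F
  yf : F

/-- The initial state. -/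
def APDGState.init {E F : Type} (x₀ : E) (y₀ : F) : APDGState E F := ⟨x₀, x₀, y₀, y₀, y₀⟩

/-- One iteration of APDG. -/
def apdgStep {ι κ : Type} [Fintype ι] [DecidableEq ι] [Fintype κ] [DecidableEq κ]
    (A : Matrix κ ι ℝ) (grad : EuclideanSpace ℝ ι → EuclideanSpace ℝ ι) (c : APDGParams)
    (s : APDGState (EuclideanSpace ℝ ι) (EuclideanSpace ℝ κ)) :
    APDGState (EuclideanSpace ℝ ι) (EuclideanSpace ℝ κ) :=
  let ym := s.y + c.θ • (s.y - s.yPrev)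
  let xg := c.τx • s.x + (1 - c.τx) • s.xf
  let yg := c.τy • s.y + (1 - c.τy) • s.yf
  let x' := s.x + (c.ηx * c.αx) • (xg - s.x)
    - (c.ηx * c.βx) • Aᵀ.toEuclideanLin (A.toEuclideanLin s.x)
    - c.ηx • (grad xg + Aᵀ.toEuclideanLin ym)
  let y' := s.y - (c.ηy * c.βy) • A.toEuclideanLin (Aᵀ.toEuclideanLin s.y + grad xg)
    + c.ηy • A.toEuclideanLin x'
  ⟨x', xg + c.σx • (x' - s.x), y', s.y, yg + c.σy • (y' - s.y)⟩

/-- The state of APDG after `N` iterations. -/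
def apdg {ι κ : Type} [Fintype ι] [DecidableEq ι] [Fintype κ] [DecidableEq κ]
    (A : Matrix κ ι ℝ) (grad : EuclideanSpace ℝ ι → EuclideanSpace ℝ ι) (c : APDGParams)
    (x₀ : EuclideanSpace ℝ ι) (y₀ : EuclideanSpace ℝ κ) :
    ℕ → APDGState (EuclideanSpace ℝ ι) (EuclideanSpace ℝ κ)
  | 0 => APDGState.init x₀ y₀
  | N + 1 => apdgStep A grad c (apdg A grad c x₀ y₀ N)

/-! ### Decentralized programs and their cost -/

/-- A decentralized program. Apart from the oracle calls below it has no access to the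
objectives, to `W` and to `B`. -/
inductive Prog (m d p : ℕ) (α : Type) : Type
  /-- stop and return a value -/
  | ret (a : α) : Prog m d p α
  /-- every node `i` calls its oracle `∇f_i` once, at its own block of `x` -/
  | grad (x : Stack m d) (k : Stack m d → Prog m d p α) : Prog m d p α
  /-- one communication round: multiplication by `𝐖` -/
  | comm (x : Stack m d) (k : Stack m d → Prog m d p α) : Prog m d p α
  /-- every node multiplies its block by `B` once -/
  | mulB (x : Stack m d) (k : Stack m p → Prog m d p α) : Prog m d p α
  /-- every node multiplies its block by `Bᵀ` once -/
  | mulBT (u : Stack m p) (k : Stack m d → Prog m d p α) : Prog m d p α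

namespace Prog

variable {m d p : ℕ}

/-- Sequential composition. -/
def andThen {α β : Type} : Prog m d p α → (α → Prog m d p β) → Prog m d p β
  | ret a, g => g a
  | grad x k, g => grad x fun z => (k z).andThen g
  | comm x k, g => comm x fun z => (k z).andThen g
  | mulB x k, g => mulB x fun z => (k z).andThen g
  | mulBT u k, g => mulBT u fun z => (k z).andThen g

instance : Monad (Prog m d p) where
  pure := ret
  bind := andThen

/-- The value that a program returns when it is run on `P`. -/
def out (P : Problem m d p) {α : Type} : Prog m d p α → α
  | ret a => a
  | grad x k => (k (P.gradF x)).out P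
  | comm x k => (k ((bigW d P.W).toEuclideanLin x)).out P
  | mulB x k => (k ((bigB m P.B).toEuclideanLin x)).out P
  | mulBT u k => (k ((bigB m P.Bᵀ).toEuclideanLin u)).out P

/-- The number of gradient calls at each node during the run on `P`. -/
def gradCalls (P : Problem m d p) {α : Type} : Prog m d p α → ℕ
  | ret _ => 0
  | grad x k => (k (P.gradF x)).gradCalls P + 1
  | comm x k => (k ((bigW d P.W).toEuclideanLin x)).gradCalls P
  | mulB x k => (k ((bigB m P.B).toEuclideanLin x)).gradCalls P
  | mulBT u k => (k ((bigB m P.Bᵀ).toEuclideanLin u)).gradCalls P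

/-- The number of communication rounds during the run on `P`. -/
def commRounds (P : Problem m d p) {α : Type} : Prog m d p α → ℕ
  | ret _ => 0
  | grad x k => (k (P.gradF x)).commRounds P
  | comm x k => (k ((bigW d P.W).toEuclideanLin x)).commRounds P + 1
  | mulB x k => (k ((bigB m P.B).toEuclideanLin x)).commRounds P
  | mulBT u k => (k ((bigB m P.Bᵀ).toEuclideanLin u)).commRounds P

/-- The number of multiplications by `B` and `Bᵀ` at each node during the run on `P`. -/
def multsB (P : Problem m d p) {α : Type} : Prog m d p α → ℕ
  | ret _ => 0
  | grad x k => (k (P.gradF x)).multsB P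
  | comm x k => (k ((bigW d P.W).toEuclideanLin x)).multsB P
  | mulB x k => (k ((bigB m P.B).toEuclideanLin x)).multsB P + 1
  | mulBT u k => (k ((bigB m P.Bᵀ).toEuclideanLin u)).multsB P + 1

/-- `x ↦ ∇F(x)`. -/
def callGrad (x : Stack m d) : Prog m d p (Stack m d) := grad x ret

/-- `x ↦ 𝐖x`. -/
def callW (x : Stack m d) : Prog m d p (Stack m d) := comm x ret

/-- `x ↦ 𝐁x`. -/
def callB (x : Stack m d) : Prog m d p (Stack m p) := mulB x ret

/-- `u ↦ 𝐁ᵀu`. -/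
def callBT (u : Stack m p) : Prog m d p (Stack m d) := mulBT u ret

/-- `x ↦ 𝐀x` for `𝐀 = [𝐁; γ𝐖]`. -/
def callA (γ : ℝ) (x : Stack m d) : Prog m d p (Mult m p d) := do
  let u ← callB x
  let v ← callW x
  return WithLp.toLp 2 (Sum.elim u.ofLp (γ • v.ofLp))

/-- `y ↦ 𝐀ᵀy` for `𝐀 = [𝐁; γ𝐖]`; recall that `W` is symmetric. -/
def callAT (γ : ℝ) (y : Mult m p d) : Prog m d p (Stack m d) := do
  let r ← callBT (WithLp.toLp 2 fun a => y (Sum.inl a))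
  let s ← callW (WithLp.toLp 2 fun a => y (Sum.inr a))
  return r + γ • s

/-- One iteration of APDG for `𝐀 = [𝐁; γ𝐖]`. -/
def apdgStep (γ : ℝ) (c : APDGParams) (s : APDGState (Stack m d) (Mult m p d)) :
    Prog m d p (APDGState (Stack m d) (Mult m p d)) := do
  let ym := s.y + c.θ • (s.y - s.yPrev)
  let xg := c.τx • s.x + (1 - c.τx) • s.xf
  let yg := c.τy • s.y + (1 - c.τy) • s.yf
  let g ← callGrad xg
  let ax ← callA γ s.x
  let atax ← callAT γ ax
  let atym ← callAT γ ym
  let x' := s.x + (c.ηx * c.αx) • (xg - s.x) - (c.ηx * c.βx) • atax - c.ηx • (g + atym)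
  let aty ← callAT γ s.y
  let h ← callA γ (aty + g)
  let ax' ← callA γ x'
  let y' := s.y - (c.ηy * c.βy) • h + c.ηy • ax'
  return ⟨x', xg + c.σx • (x' - s.x), y', s.y, yg + c.σy • (y' - s.y)⟩

/-- `N` iterations of APDG for `𝐀 = [𝐁; γ𝐖]`. -/
def apdg (γ : ℝ) (c : APDGParams) (x₀ : Stack m d) (y₀ : Mult m p d) :
    ℕ → Prog m d p (APDGState (Stack m d) (Mult m p d))
  | 0 => return APDGState.init x₀ y₀
  | N + 1 => do
    let s ← apdg γ c x₀ y₀ N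
    apdgStep γ c s

/-- The first `j` steps of Horner's rule for `q(T) x`, where `op` computes `T`. -/
def hornerAux (op : Stack m d → Prog m d p (Stack m d)) (q : Polynomial ℝ) (x : Stack m d) :
    ℕ → Prog m d p (Stack m d)
  | 0 => return q.coeff q.natDegree • x
  | j + 1 => do
    let a ← hornerAux op q x j
    let b ← op a
    return b + q.coeff (q.natDegree - (j + 1)) • x

/-- `x ↦ q(T) x` with `deg q` calls of the program `op` that computes `T`. -/
def horner (op : Stack m d → Prog m d p (Stack m d)) (q : Polynomial ℝ) (x : Stack m d) :
    Prog m d p (Stack m d) :=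
  hornerAux op q x q.natDegree

/-- `x ↦ 𝐁ᵀ𝐁x`. -/
def callBTB (x : Stack m d) : Prog m d p (Stack m d) := do
  let u ← callB x
  callBT u

/-- `x ↦ qB(𝐁ᵀ𝐁)x + γ² qW(𝐖)² x`. -/
def callGram (qW qB : Polynomial ℝ) (γ : ℝ) (x : Stack m d) : Prog m d p (Stack m d) := do
  let r ← horner callBTB qB x
  let s ← horner callW qW x
  let t ← horner callW qW s
  return r + γ ^ 2 • t

/-- One iteration of APDG in the variables `p = 𝐀ᵀy`, in which it uses `𝐀` only through `𝐀ᵀ𝐀`,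
with `W` replaced by `qW(W)` and `BᵀB` replaced by `qB(BᵀB)`. -/
def accStep (qW qB : Polynomial ℝ) (γ : ℝ) (c : APDGParams)
    (s : APDGState (Stack m d) (Stack m d)) :
    Prog m d p (APDGState (Stack m d) (Stack m d)) := do
  let pm := s.y + c.θ • (s.y - s.yPrev)
  let xg := c.τx • s.x + (1 - c.τx) • s.xf
  let pg := c.τy • s.y + (1 - c.τy) • s.yf
  let g ← callGrad xg
  let atax ← callGram qW qB γ s.x
  let x' := s.x + (c.ηx * c.αx) • (xg - s.x) - (c.ηx * c.βx) • atax - c.ηx • (g + pm)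
  let h ← callGram qW qB γ (s.y + g)
  let atax' ← callGram qW qB γ x'
  let p' := s.y - (c.ηy * c.βy) • h + c.ηy • atax'
  return ⟨x', xg + c.σx • (x' - s.x), p', s.y, pg + c.σy • (p' - s.y)⟩

/-- `N` iterations of the accelerated method. -/
def acc (qW qB : Polynomial ℝ) (γ : ℝ) (c : APDGParams) (x₀ p₀ : Stack m d) :
    ℕ → Prog m d p (APDGState (Stack m d) (Stack m d))
  | 0 => return APDGState.init x₀ p₀
  | N + 1 => do
    let s ← acc qW qB γ c x₀ p₀ N
    accStep qW qB γ c s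

end Prog

/-! ### Chebyshev acceleration -/

/-- The shifted and normalized Chebyshev polynomial
`1 - T_K((u + l - 2 X) / (u - l)) / T_K((u + l) / (u - l))`, which vanishes at `0` and is close
to `1` on `[l, u]`. If `l = u`, it is `X / u`. -/
def chebPoly (l u : ℝ) (K : ℕ) : Polynomial ℝ :=
  if l = u then Polynomial.C u⁻¹ * Polynomial.X
  else 1 - Polynomial.C (((Polynomial.Chebyshev.T ℝ K).eval ((u + l) / (u - l)))⁻¹) *
    (Polynomial.Chebyshev.T ℝ K).comp
      (Polynomial.C ((u + l) / (u - l)) - Polynomial.C (2 / (u - l)) * Polynomial.X)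

/-- The Chebyshev polynomial for `M`, of degree `⌊√χ(M)⌋`. -/
def cheb {ι : Type} [Fintype ι] [DecidableEq ι] (M : Matrix ι ι ℝ) : Polynomial ℝ :=
  chebPoly (lamMinPos M) (lamMax M) ⌊√(condNum M)⌋₊

namespace Problem

variable {m d p : ℕ}

/-- `P_K(W)`. -/
def chebW (P : Problem m d p) : Matrix (Fin m) (Fin m) ℝ :=
  Polynomial.aeval P.W (cheb P.W)

/-- `P_M(BᵀB)`. -/
def chebBTB (P : Problem m d p) : Matrix (Fin d) (Fin d) ℝ :=
  Polynomial.aeval (P.Bᵀ * P.B) (cheb (P.Bᵀ * P.B))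

/-- The optimal `γ` after the replacement of `W` and `BᵀB`. -/
def gammaCheb (P : Problem m d p) : ℝ := gammaOpt P.chebBTB P.chebW

/-- `𝐀ᵀ𝐀` after the replacement: `I ⊗ P_M(BᵀB) + γ² P_K(W)² ⊗ I`. -/
def gramCheb (P : Problem m d p) : Matrix (Fin m × Fin d) (Fin m × Fin d) ℝ :=
  bigB m P.chebBTB + P.gammaCheb ^ 2 • bigW d (P.chebW * P.chebW)

/-- The size of the initial error of a method started at `x₀` and `p₀ = 𝐀ᵀy₀`, with solution
`xs`; note that `-∇F(xs)` is the optimal value of `𝐀ᵀy`. -/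
def initError (P : Problem m d p) (xs x₀ p₀ : Stack m d) : ℝ :=
  ‖x₀ - xs‖ + (‖p₀‖ + ‖P.gradF xs‖) / P.μ

/-- After `C · κ · log(D/ε)` iterations the distance of the iterates `x` to the solution `xs` is at
most `ε`. The same holds for the error of the objective and for the violation of the constraints
if `D` is replaced by `L D²` and by `σ_max(𝐀) D`. -/
def HasComplexity (P : Problem m d p) (C κ D : ℝ) (xs : Stack m d) (x : ℕ → Stack m d) : Prop :=
  ∀ ε : ℝ, 0 < ε → ∀ N : ℕ,
    (C * κ * Real.log (D / ε) ≤ N → ‖x N - xs‖ ≤ ε) ∧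
    (C * κ * Real.log (P.L * D ^ 2 / ε) ≤ N → |P.F (x N) - P.F xs| ≤ ε) ∧
    (C * κ * Real.log (√(lamMax (P.Aᵀ * P.A)) * D / ε) ≤ N → ‖P.A.toEuclideanLin (x N)‖ ≤ ε)

/-- The parameters for a constraint matrix `𝐀` with `𝐀ᵀ𝐀 = M`, given the rule `par` that computes
them from `μ`, `L`, `λ_min⁺(𝐀ᵀ𝐀)` and `λ_max(𝐀ᵀ𝐀)`. -/
def params (P : Problem m d p) (par : ℝ → ℝ → ℝ → ℝ → APDGParams)
    (M : Matrix (Fin m × Fin d) (Fin m × Fin d) ℝ) : APDGParams :=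
  par P.μ P.L (lamMinPos M) (lamMax M)

/-- `N` iterations of APDG for `𝐀 = [𝐁; γ𝐖]` at the optimal `γ`. -/
def directProg (P : Problem m d p) (par : ℝ → ℝ → ℝ → ℝ → APDGParams)
    (x₀ : Stack m d) (y₀ : Mult m p d) (N : ℕ) :
    Prog m d p (APDGState (Stack m d) (Mult m p d)) :=
  Prog.apdg (gammaOpt (P.Bᵀ * P.B) P.W) (P.params par (P.Aᵀ * P.A)) x₀ y₀ N

/-- `N` iterations of APDG with Chebyshev acceleration. -/
def chebProg (P : Problem m d p) (par : ℝ → ℝ → ℝ → ℝ → APDGParams)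
    (x₀ p₀ : Stack m d) (N : ℕ) : Prog m d p (APDGState (Stack m d) (Stack m d)) :=
  Prog.acc (cheb P.W) (cheb (P.Bᵀ * P.B)) P.gammaCheb (P.params par P.gramCheb) x₀ p₀ N

end Problem

end DecOpt

end

open DecOpt

/-!
Let `(x*, y*)` be the saddle point of `F(x) + ⟨y, A x⟩` with `y* ∈ range A`. A weighted sum of
`‖x - x*‖²`, of the Bregman divergence between `x*` and `x_f` and of `‖y - y*‖²`, corrected by terms
in `y^k - y^{k-1}` that absorb the extrapolation, contracts by the factor `θ` at each step of APDG:
strong convexity of `F` pays for the primal part, and since `y - y*` stays in `range A`, where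
`‖Aᵀ y‖² ≥ λ_min⁺ ‖y‖²`, the gradient step on the dual pays for the rest. With the chosen parameters
`1 - θ` is of order `1 / max {√χ √(L/μ), χ}`.

As `BᵀB` and `W²` are singular, the spectrum of the Kronecker sum
`AᵀA = I ⊗ BᵀB + γ² W² ⊗ I` contains the spectra of both summands, so that
`λ_max(AᵀA) = λ_max(BᵀB) + γ² λ_max(W)²` and `λ_min⁺(AᵀA) = min {λ_min⁺(BᵀB), γ² λ_min⁺(W)²}`. The
ratio is least when the two terms of the minimum agree.

On `[λ_min⁺, λ_max]` the Chebyshev polynomial of degree `⌊√χ⌋` takes values in a fixed interval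
around `1`, while it vanishes at `0`; it therefore preserves kernels and brings condition numbers
down to at most `4`. In the variables `p = Aᵀ y` APDG only uses `AᵀA`, so no square root of
`P(BᵀB)` has to be computed.
-/

namespace DecOpt

/-! ### Spectra of symmetric matrices -/

section Spectrum

open Polynomial

variable {ι κ : Type*} [Fintype ι] [DecidableEq ι] [Fintype κ] [DecidableEq κ]
  {M : Matrix ι ι ℝ}

theorem transpose_eq_of_isHermitian {ι : Type*} {M : Matrix ι ι ℝ} (hM : M.IsHermitian) :
    Mᵀ = M := by
  rw [← Matrix.conjTranspose_eq_transpose_of_trivial, hM.eq]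

theorem spectrum_aeval (hM : M.IsHermitian) (q : ℝ[X]) :
    spectrum ℝ (aeval M q) = (fun t => q.eval t) '' spectrum ℝ M := by
  rw [← cfc_polynomial q M hM.isSelfAdjoint,
    cfc_map_spectrum _ M hM.isSelfAdjoint q.continuous.continuousOn]

theorem isHermitian_aeval (hM : M.IsHermitian) (q : ℝ[X]) : (aeval M q).IsHermitian := by
  rw [← cfc_polynomial q M hM.isSelfAdjoint]
  exact cfc_predicate _ M

theorem posSemidef_aeval (hM : M.IsHermitian) {q : ℝ[X]}
    (hq : ∀ t ∈ spectrum ℝ M, 0 ≤ q.eval t) : (aeval M q).PosSemidef := by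
  rw [Matrix.posSemidef_iff_isHermitian_and_spectrum_nonneg, spectrum_aeval hM]
  exact ⟨isHermitian_aeval hM q, Set.image_subset_iff.mpr hq⟩

theorem aeval_mulVec_eq_zero_of_aeval_mulVec_eq_zero (hM : M.IsHermitian) {q r : ℝ[X]}
    (hqr : ∀ t ∈ spectrum ℝ M, q.eval t = 0 → r.eval t = 0) {x : ι → ℝ}
    (hx : aeval M q *ᵥ x = 0) : aeval M r *ᵥ x = 0 := by
  have hfin : (spectrum ℝ M).Finite := Matrix.finite_real_spectrum
  have hfactor : aeval M r = cfc (fun t => r.eval t / q.eval t) M * aeval M q := by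
    rw [← cfc_polynomial q M hM.isSelfAdjoint, ← cfc_polynomial r M hM.isSelfAdjoint,
      ← cfc_mul _ _ M (hfin.continuousOn _) q.continuous.continuousOn]
    exact cfc_congr fun t ht => (div_mul_cancel_of_imp (hqr t ht)).symm
  rw [hfactor, ← Matrix.mulVec_mulVec, hx, Matrix.mulVec_zero]

theorem aeval_mulVec_eq_zero_iff (hM : M.IsHermitian) {q : ℝ[X]}
    (hq : ∀ t ∈ spectrum ℝ M, q.eval t = 0 ↔ t = 0) {x : ι → ℝ} :
    aeval M q *ᵥ x = 0 ↔ M *ᵥ x = 0 := by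
  constructor <;> intro hx
  · simpa only [aeval_X] using aeval_mulVec_eq_zero_of_aeval_mulVec_eq_zero (r := X) hM
      (fun t ht h => by rw [eval_X, (hq t ht).mp h]) hx
  · refine aeval_mulVec_eq_zero_of_aeval_mulVec_eq_zero (q := X) hM
      (fun t ht h => (hq t ht).mpr (by rwa [eval_X] at h)) ?_
    rwa [aeval_X]

theorem zero_mem_spectrum_of_mulVec_eq_zero {x : ι → ℝ} (hx : x ≠ 0) (h : M *ᵥ x = 0) :
    0 ∈ spectrum ℝ M := by
  rw [spectrum.zero_mem_iff, Matrix.isUnit_iff_isUnit_det, isUnit_iff_ne_zero, not_not]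
  exact Matrix.exists_mulVec_eq_zero_iff.mp ⟨x, hx, h⟩

theorem spectrum_nonempty_of_isHermitian [Nonempty ι] (hM : M.IsHermitian) :
    (spectrum ℝ M).Nonempty :=
  hM.spectrum_real_eq_range_eigenvalues ▸ Set.range_nonempty _

theorem spectrum_sdiff_zero_nonempty (hM : M.IsHermitian) (h0 : M ≠ 0) :
    (spectrum ℝ M \ {0}).Nonempty := by
  by_contra hempty
  refine h0 (CFC.eq_zero_of_spectrum_subset_zero (R := ℝ) M ?_ hM.isSelfAdjoint)
  rwa [Set.not_nonempty_iff_eq_empty, Set.sdiff_eq_empty] at hempty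

theorem spectrum_nonneg_of_posSemidef (hM : M.PosSemidef) {t : ℝ} (ht : t ∈ spectrum ℝ M) :
    0 ≤ t :=
  (Matrix.posSemidef_iff_isHermitian_and_spectrum_nonneg.mp hM).2 ht

theorem nonempty_of_matrix_ne_zero {ι : Type*} {M : Matrix ι ι ℝ} (h0 : M ≠ 0) : Nonempty ι :=
  not_isEmpty_iff.mp fun _ => h0 (Subsingleton.elim _ _)

theorem posSemidef_transpose_mul_self {ι κ : Type*} [Finite ι] [Fintype κ] (A : Matrix κ ι ℝ) :
    (Aᵀ * A).PosSemidef := by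
  simpa only [Matrix.conjTranspose_eq_transpose_of_trivial] using
    Matrix.posSemidef_conjTranspose_mul_self A

theorem exists_transpose_mul_self_eq {ι : Type*} [Fintype ι] {M : Matrix ι ι ℝ}
    (hM : M.PosSemidef) : ∃ B : Matrix ι ι ℝ, Bᵀ * B = M := by
  classical
  have hsqrt : (cfc Real.sqrt M).IsHermitian := cfc_predicate _ M
  refine ⟨cfc Real.sqrt M, ?_⟩
  calc (cfc Real.sqrt M)ᵀ * cfc Real.sqrt M = cfc (fun t => √t * √t) M := by
        rw [transpose_eq_of_isHermitian hsqrt, ← cfc_mul ..]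
    _ = cfc id M := cfc_congr fun t ht => Real.mul_self_sqrt (spectrum_nonneg_of_posSemidef hM ht)
    _ = M := cfc_id ℝ M hM.1.isSelfAdjoint

theorem spectrum_kroneckerSum {Q : Matrix κ κ ℝ} (hM : M.IsHermitian) (hQ : Q.IsHermitian) :
    spectrum ℝ ((1 : Matrix ι ι ℝ) ⊗ₖ Q + M ⊗ₖ (1 : Matrix κ κ ℝ)) =
      Set.image2 (· + ·) (spectrum ℝ Q) (spectrum ℝ M) := by
  set U := hM.eigenvectorUnitary
  set V := hQ.eigenvectorUnitary
  set D := Matrix.diagonal hM.eigenvalues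
  set E := Matrix.diagonal hQ.eigenvalues
  have hU : (U : Matrix ι ι ℝ) * star (U : Matrix ι ι ℝ) = 1 := Unitary.coe_mul_star_self U
  have hV : (V : Matrix κ κ ℝ) * star (V : Matrix κ κ ℝ) = 1 := Unitary.coe_mul_star_self V
  have hMD : M = U * D * star (U : Matrix ι ι ℝ) := hM.spectral_theorem
  have hQE : Q = V * E * star (V : Matrix κ κ ℝ) := hQ.spectral_theorem
  let UV : unitary (Matrix (ι × κ) (ι × κ) ℝ) := ⟨U ⊗ₖ V, Matrix.kronecker_mem_unitary U.2 V.2⟩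
  have hstar : star (UV : Matrix (ι × κ) (ι × κ) ℝ) =
      star (U : Matrix ι ι ℝ) ⊗ₖ star (V : Matrix κ κ ℝ) := Matrix.conjTranspose_kronecker _ _
  have hconj : (1 : Matrix ι ι ℝ) ⊗ₖ Q + M ⊗ₖ (1 : Matrix κ κ ℝ) =
      UV * ((1 : Matrix ι ι ℝ) ⊗ₖ E + D ⊗ₖ (1 : Matrix κ κ ℝ)) *
        star (UV : Matrix (ι × κ) (ι × κ) ℝ) := by
    rw [hstar, Matrix.mul_add, Matrix.add_mul]
    simp only [UV, ← Matrix.mul_kronecker_mul, Matrix.mul_one, hU, hV, ← hMD, ← hQE]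
  have hdiag : (1 : Matrix ι ι ℝ) ⊗ₖ E + D ⊗ₖ (1 : Matrix κ κ ℝ) =
      Matrix.diagonal fun ij => hQ.eigenvalues ij.2 + hM.eigenvalues ij.1 := by
    simp only [D, E, ← Matrix.diagonal_one, Matrix.diagonal_kronecker_diagonal,
      Matrix.diagonal_add, one_mul, mul_one]
  rw [hconj, Unitary.spectrum_star_right_conjugate, hdiag, spectrum_diagonal,
    hM.spectrum_real_eq_range_eigenvalues, hQ.spectrum_real_eq_range_eigenvalues]
  ext t
  simp only [Set.mem_range, Set.mem_image2, Prod.exists, exists_exists_eq_and]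
  exact exists_comm

end Spectrum

section ExtremeEigenvalues

open Polynomial

variable {ι κ : Type} [Fintype ι] [DecidableEq ι] [Fintype κ] [DecidableEq κ]
  {M : Matrix ι ι ℝ} {Q : Matrix κ κ ℝ}

theorem isGreatest_lamMax [Nonempty ι] (hM : M.IsHermitian) :
    IsGreatest (spectrum ℝ M) (lamMax M) :=
  have hfin : (spectrum ℝ M).Finite := Matrix.finite_real_spectrum
  ⟨(spectrum_nonempty_of_isHermitian hM).csSup_mem hfin, fun _ ht => le_csSup hfin.bddAbove ht⟩

theorem isLeast_lamMinPos (hM : M.IsHermitian) (h0 : M ≠ 0) :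
    IsLeast (spectrum ℝ M \ {0}) (lamMinPos M) :=
  have hfin : (spectrum ℝ M \ {0}).Finite := Matrix.finite_real_spectrum.sdiff
  ⟨(spectrum_sdiff_zero_nonempty hM h0).csInf_mem hfin, fun _ ht => csInf_le hfin.bddBelow ht⟩

theorem le_lamMax_of_mem_spectrum {t : ℝ} (ht : t ∈ spectrum ℝ M) : t ≤ lamMax M :=
  le_csSup Matrix.finite_real_spectrum.bddAbove ht

theorem lamMinPos_le_of_mem_spectrum {t : ℝ} (ht : t ∈ spectrum ℝ M) (ht0 : t ≠ 0) :
    lamMinPos M ≤ t :=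
  csInf_le Matrix.finite_real_spectrum.sdiff.bddBelow ⟨ht, ht0⟩

theorem lamMinPos_pos (hM : M.PosSemidef) (h0 : M ≠ 0) : 0 < lamMinPos M :=
  have hmem := (isLeast_lamMinPos hM.1 h0).1
  (spectrum_nonneg_of_posSemidef hM hmem.1).lt_of_ne' hmem.2

theorem lamMinPos_le_lamMax (hM : M.IsHermitian) (h0 : M ≠ 0) : lamMinPos M ≤ lamMax M :=
  le_lamMax_of_mem_spectrum (isLeast_lamMinPos hM h0).1.1

theorem lamMax_pos (hM : M.PosSemidef) (h0 : M ≠ 0) : 0 < lamMax M :=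
  (lamMinPos_pos hM h0).trans_le (lamMinPos_le_lamMax hM.1 h0)

theorem lamMax_nonneg (hM : M.PosSemidef) : 0 ≤ lamMax M :=
  Real.sSup_nonneg fun _ => spectrum_nonneg_of_posSemidef hM

theorem one_le_condNum (hM : M.PosSemidef) (h0 : M ≠ 0) : 1 ≤ condNum M :=
  (one_le_div (lamMinPos_pos hM h0)).mpr (lamMinPos_le_lamMax hM.1 h0)

theorem dotProduct_mulVec_le_lamMax_mul (hM : M.IsHermitian) (x : ι → ℝ) :
    x ⬝ᵥ (M *ᵥ x) ≤ lamMax M * (x ⬝ᵥ x) := by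
  have hpsd : (aeval M (C (lamMax M) - X)).PosSemidef := posSemidef_aeval hM fun t ht => by
    simpa only [eval_sub, eval_C, eval_X, sub_nonneg] using le_lamMax_of_mem_spectrum ht
  have hquad := hpsd.dotProduct_mulVec_nonneg x
  simp only [star_trivial, map_sub, aeval_C, aeval_X, Algebra.algebraMap_eq_smul_one,
    Matrix.sub_mulVec, Matrix.smul_mulVec, Matrix.one_mulVec, dotProduct_sub,
    dotProduct_smul, smul_eq_mul] at hquad
  linarith

theorem lamMinPos_mul_dotProduct_mulVec_le (hM : M.PosSemidef) (x : ι → ℝ) :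
    lamMinPos M * (x ⬝ᵥ (M *ᵥ x)) ≤ (M *ᵥ x) ⬝ᵥ (M *ᵥ x) := by
  have hpsd : (aeval M (X * X - C (lamMinPos M) * X)).PosSemidef :=
    posSemidef_aeval hM.1 fun t ht => by
      have ht_nonneg := spectrum_nonneg_of_posSemidef hM ht
      simp only [eval_sub, eval_mul, eval_C, eval_X, sub_nonneg]
      rcases eq_or_ne t 0 with rfl | ht0
      · simp only [mul_zero, le_refl]
      · exact mul_le_mul_of_nonneg_right (lamMinPos_le_of_mem_spectrum ht ht0) ht_nonneg
  have hquad := hpsd.dotProduct_mulVec_nonneg x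
  have hself : (M *ᵥ x) ⬝ᵥ (M *ᵥ x) = x ⬝ᵥ ((M * M) *ᵥ x) := by
    rw [Matrix.dotProduct_mulVec, Matrix.vecMul_mulVec, transpose_eq_of_isHermitian hM.1,
      ← Matrix.dotProduct_mulVec]
  simp only [star_trivial, map_sub, map_mul, aeval_C, aeval_X, Algebra.algebraMap_eq_smul_one,
    Matrix.sub_mulVec, smul_mul_assoc, one_mul, Matrix.smul_mulVec, dotProduct_sub,
    dotProduct_smul, smul_eq_mul] at hquad
  linarith

theorem condNum_le_div_of_spectrum_subset {l u : ℝ} (hM : M.PosSemidef) (h0 : M ≠ 0) (hl : 0 < l)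
    (hspec : spectrum ℝ M \ {0} ⊆ Set.Icc l u) : condNum M ≤ u / l := by
  have := nonempty_of_matrix_ne_zero h0
  have hmax := hspec ⟨(isGreatest_lamMax hM.1).1, (lamMax_pos hM h0).ne'⟩
  have hmin := hspec (isLeast_lamMinPos hM.1 h0).1
  exact div_le_div₀ (hl.le.trans (hmax.1.trans hmax.2)) hmax.2 hl hmin.1

theorem lamMax_kroneckerSum [Nonempty ι] [Nonempty κ] (hM : M.IsHermitian) (hQ : Q.IsHermitian) :
    lamMax ((1 : Matrix ι ι ℝ) ⊗ₖ Q + M ⊗ₖ (1 : Matrix κ κ ℝ)) = lamMax Q + lamMax M := by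
  refine IsGreatest.csSup_eq ?_
  rw [spectrum_kroneckerSum hM hQ]
  exact ⟨Set.mem_image2_of_mem (isGreatest_lamMax hQ).1 (isGreatest_lamMax hM).1,
    Set.forall_mem_image2.mpr fun β hβ ω hω =>
      add_le_add (le_lamMax_of_mem_spectrum hβ) (le_lamMax_of_mem_spectrum hω)⟩

theorem lamMinPos_kroneckerSum (hM : M.PosSemidef) (hQ : Q.PosSemidef) (hM0 : M ≠ 0) (hQ0 : Q ≠ 0)
    (hMz : 0 ∈ spectrum ℝ M) (hQz : 0 ∈ spectrum ℝ Q) :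
    lamMinPos ((1 : Matrix ι ι ℝ) ⊗ₖ Q + M ⊗ₖ (1 : Matrix κ κ ℝ)) =
      min (lamMinPos Q) (lamMinPos M) := by
  have hleastQ := isLeast_lamMinPos hQ.1 hQ0
  have hleastM := isLeast_lamMinPos hM.1 hM0
  refine IsLeast.csInf_eq ?_
  rw [spectrum_kroneckerSum hM.1 hQ.1]
  constructor
  · rcases min_choice (lamMinPos Q) (lamMinPos M) with h | h <;> rw [h]
    · exact ⟨⟨_, hleastQ.1.1, 0, hMz, add_zero _⟩, hleastQ.1.2⟩
    · exact ⟨⟨0, hQz, _, hleastM.1.1, zero_add _⟩, hleastM.1.2⟩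
  · rintro _ ⟨⟨β, hβ, ω, hω, rfl⟩, hne⟩
    have hβ_nonneg := spectrum_nonneg_of_posSemidef hQ hβ
    have hω_nonneg := spectrum_nonneg_of_posSemidef hM hω
    rcases eq_or_ne β 0 with rfl | hβ0
    · have hω0 : ω ≠ 0 := fun hω0 => hne (by simp [hω0])
      exact (min_le_right _ _).trans
        ((lamMinPos_le_of_mem_spectrum hω hω0).trans (zero_add ω).ge)
    · exact (min_le_left _ _).trans
        ((lamMinPos_le_of_mem_spectrum hβ hβ0).trans (le_add_of_nonneg_right hω_nonneg))

theorem kroneckerSum_ne_zero {ι κ : Type} [Finite ι] [DecidableEq ι] [Finite κ] [DecidableEq κ]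
    {M : Matrix ι ι ℝ} {Q : Matrix κ κ ℝ} (hM : M.PosSemidef) (hQ : Q.PosSemidef) (hM0 : M ≠ 0)
    (hQ0 : Q ≠ 0) :
    (1 : Matrix ι ι ℝ) ⊗ₖ Q + M ⊗ₖ (1 : Matrix κ κ ℝ) ≠ 0 := by
  have := Fintype.ofFinite ι
  have := Fintype.ofFinite κ
  have := nonempty_of_matrix_ne_zero hM0
  have := nonempty_of_matrix_ne_zero hQ0
  intro hzero
  have hlam := lamMax_kroneckerSum hM.1 hQ.1
  rw [hzero, lamMax, spectrum.zero_eq, csSup_singleton] at hlam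
  exact (add_pos (lamMax_pos hQ hQ0) (lamMax_pos hM hM0)).ne hlam

end ExtremeEigenvalues

/-! ### The condition number of the stacked constraint matrix -/

section Gram

open Polynomial

theorem smul_mul_self_eq_aeval {ι : Type*} [Fintype ι] [DecidableEq ι] (M : Matrix ι ι ℝ) (c : ℝ) :
    c • (M * M) = aeval M (C c * X ^ 2 : ℝ[X]) := by
  rw [map_mul, aeval_C, map_pow, aeval_X, sq, Algebra.smul_def]

theorem spectrum_smul_mul_self {ι : Type*} [Fintype ι] [DecidableEq ι] {M : Matrix ι ι ℝ}
    (hM : M.IsHermitian) (c : ℝ) :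
    spectrum ℝ (c • (M * M)) = (fun t => c * t ^ 2) '' spectrum ℝ M := by
  simp only [smul_mul_self_eq_aeval, spectrum_aeval hM, eval_mul, eval_C, eval_pow, eval_X]

theorem smul_mul_self_ne_zero {ι : Type*} [Fintype ι] {M : Matrix ι ι ℝ} {c : ℝ}
    (hM : M.IsHermitian) (hM0 : M ≠ 0) (hc : c ≠ 0) :
    c • (M * M) ≠ 0 := by
  rw [smul_ne_zero_iff]
  refine ⟨hc, fun hMM => hM0 ?_⟩
  rwa [← Matrix.conjTranspose_mul_self_eq_zero, hM.eq]

section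

variable {ι : Type} [Fintype ι] [DecidableEq ι] {M : Matrix ι ι ℝ} {c : ℝ}

theorem lamMax_smul_mul_self (hM : M.PosSemidef) (hM0 : M ≠ 0) (hc : 0 ≤ c) :
    lamMax (c • (M * M)) = c * lamMax M ^ 2 := by
  have := nonempty_of_matrix_ne_zero hM0
  refine IsGreatest.csSup_eq ?_
  rw [spectrum_smul_mul_self hM.1]
  refine ⟨Set.mem_image_of_mem _ (isGreatest_lamMax hM.1).1, Set.forall_mem_image.mpr ?_⟩
  intro t ht
  have ht_nonneg := spectrum_nonneg_of_posSemidef hM ht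
  have ht_le := le_lamMax_of_mem_spectrum ht
  gcongr

theorem lamMinPos_smul_mul_self (hM : M.PosSemidef) (hM0 : M ≠ 0) (hc : 0 < c) :
    lamMinPos (c • (M * M)) = c * lamMinPos M ^ 2 := by
  have hl := lamMinPos_pos hM hM0
  refine IsLeast.csInf_eq ?_
  rw [spectrum_smul_mul_self hM.1]
  refine ⟨⟨Set.mem_image_of_mem _ (isLeast_lamMinPos hM.1 hM0).1.1, ?_⟩, ?_⟩
  · exact (mul_pos hc (pow_pos hl 2)).ne'
  · rintro _ ⟨⟨t, ht, rfl⟩, hne⟩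
    have ht0 : t ≠ 0 := fun ht0 => hne (by simp [ht0])
    have ht_ge := lamMinPos_le_of_mem_spectrum ht ht0
    dsimp only
    gcongr

theorem posSemidef_smul_mul_self {ι : Type*} [Fintype ι] {M : Matrix ι ι ℝ} {c : ℝ}
    (hM : M.IsHermitian) (hc : 0 ≤ c) : (c • (M * M)).PosSemidef := by
  classical
  rw [smul_mul_self_eq_aeval]
  refine posSemidef_aeval hM fun t _ => ?_
  rw [eval_mul, eval_C, eval_pow, eval_X]
  positivity

theorem zero_mem_spectrum_smul_mul_self (hM : M.IsHermitian) (hz : 0 ∈ spectrum ℝ M) :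
    0 ∈ spectrum ℝ (c • (M * M)) := by
  rw [spectrum_smul_mul_self hM]
  exact ⟨0, hz, by simp⟩

end

theorem bigB_transpose {m d q : ℕ} (B : Matrix (Fin q) (Fin d) ℝ) : (bigB m B)ᵀ = bigB m Bᵀ := by
  rw [bigB, bigB, ← Matrix.kroneckerMap_transpose, Matrix.transpose_one]

variable {m d : ℕ}

theorem bigW_transpose {W : Matrix (Fin m) (Fin m) ℝ} (hW : W.IsHermitian) :
    (bigW d W)ᵀ = bigW d W := by
  rw [bigW, ← Matrix.kroneckerMap_transpose, Matrix.transpose_one, transpose_eq_of_isHermitian hW]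

theorem bigB_mul {d q r : ℕ} (B : Matrix (Fin q) (Fin d) ℝ) (B' : Matrix (Fin d) (Fin r) ℝ) :
    bigB m B * bigB m B' = bigB m (B * B') := by
  rw [bigB, bigB, bigB, ← Matrix.mul_kronecker_mul, Matrix.one_mul]

theorem bigW_mul (W W' : Matrix (Fin m) (Fin m) ℝ) :
    bigW d W * bigW d W' = bigW d (W * W') := by
  rw [bigW, bigW, bigW, ← Matrix.mul_kronecker_mul, Matrix.one_mul]

theorem conMat_transpose_mul_conMat {q : ℕ} (B : Matrix (Fin q) (Fin d) ℝ)
    {W : Matrix (Fin m) (Fin m) ℝ} (hW : W.IsHermitian) (γ : ℝ) :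
    (conMat B W γ)ᵀ * conMat B W γ = bigB m (Bᵀ * B) + γ ^ 2 • bigW d (W * W) := by
  rw [conMat, Matrix.transpose_fromRows, Matrix.fromCols_mul_fromRows, Matrix.transpose_smul,
    bigB_transpose, bigW_transpose hW, Matrix.smul_mul, Matrix.mul_smul, smul_smul, bigB_mul,
    bigW_mul, sq]

variable {Q : Matrix (Fin d) (Fin d) ℝ} {W : Matrix (Fin m) (Fin m) ℝ}

theorem bigB_add_smul_bigW_eq_kroneckerSum (γ : ℝ) :
    bigB m Q + γ ^ 2 • bigW d (W * W) =
      (1 : Matrix (Fin m) (Fin m) ℝ) ⊗ₖ Q +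
        (γ ^ 2 • (W * W)) ⊗ₖ (1 : Matrix (Fin d) (Fin d) ℝ) := by
  rw [bigB, bigW, Matrix.smul_kronecker]

theorem lamMax_gram (hQ : Q.PosSemidef) (hW : W.PosSemidef) (hQ0 : Q ≠ 0) (hW0 : W ≠ 0) (γ : ℝ) :
    lamMax (bigB m Q + γ ^ 2 • bigW d (W * W)) = lamMax Q + γ ^ 2 * lamMax W ^ 2 := by
  have := nonempty_of_matrix_ne_zero hQ0
  have := nonempty_of_matrix_ne_zero hW0
  rw [bigB_add_smul_bigW_eq_kroneckerSum,
    lamMax_kroneckerSum (posSemidef_smul_mul_self hW.1 (sq_nonneg γ)).1 hQ.1,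
    lamMax_smul_mul_self hW hW0 (sq_nonneg γ)]

theorem lamMinPos_gram (hQ : Q.PosSemidef) (hW : W.PosSemidef) (hQ0 : Q ≠ 0) (hW0 : W ≠ 0)
    (hQz : 0 ∈ spectrum ℝ Q) (hWz : 0 ∈ spectrum ℝ W) {γ : ℝ} (hγ : γ ≠ 0) :
    lamMinPos (bigB m Q + γ ^ 2 • bigW d (W * W)) =
      min (lamMinPos Q) (γ ^ 2 * lamMinPos W ^ 2) := by
  have hγ2 : 0 < γ ^ 2 := by positivity
  rw [bigB_add_smul_bigW_eq_kroneckerSum,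
    lamMinPos_kroneckerSum (posSemidef_smul_mul_self hW.1 hγ2.le) hQ
      (smul_mul_self_ne_zero hW.1 hW0 hγ2.ne') hQ0 (zero_mem_spectrum_smul_mul_self hW.1 hWz) hQz,
    lamMinPos_smul_mul_self hW hW0 hγ2]

theorem gram_ne_zero (hQ : Q.PosSemidef) (hQ0 : Q ≠ 0) (hW : W.IsHermitian) (hW0 : W ≠ 0)
    {γ : ℝ} (hγ : γ ≠ 0) : bigB m Q + γ ^ 2 • bigW d (W * W) ≠ 0 := by
  have hγ2 : 0 < γ ^ 2 := by positivity
  rw [bigB_add_smul_bigW_eq_kroneckerSum]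
  exact kroneckerSum_ne_zero (posSemidef_smul_mul_self hW hγ2.le) hQ
    (smul_mul_self_ne_zero hW hW0 hγ2.ne') hQ0

theorem gammaOpt_pos (hQ : Q.PosSemidef) (hQ0 : Q ≠ 0) (hW : W.PosSemidef) (hW0 : W ≠ 0) :
    0 < gammaOpt Q W :=
  div_pos (Real.sqrt_pos.mpr (lamMinPos_pos hQ hQ0)) (lamMinPos_pos hW hW0)

theorem condNum_gram_gammaOpt (hQ : Q.PosSemidef) (hW : W.PosSemidef) (hQ0 : Q ≠ 0) (hW0 : W ≠ 0)
    (hQz : 0 ∈ spectrum ℝ Q) (hWz : 0 ∈ spectrum ℝ W) :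
    condNum (bigB m Q + gammaOpt Q W ^ 2 • bigW d (W * W)) = condNum W ^ 2 + condNum Q := by
  have hlQ := lamMinPos_pos hQ hQ0
  have hlW := lamMinPos_pos hW hW0
  have hγ : gammaOpt Q W ^ 2 = lamMinPos Q / lamMinPos W ^ 2 := by
    rw [gammaOpt, div_pow, Real.sq_sqrt hlQ.le]
  rw [condNum, lamMax_gram hQ hW hQ0 hW0,
    lamMinPos_gram hQ hW hQ0 hW0 hQz hWz (gammaOpt_pos hQ hQ0 hW hW0).ne', hγ,
    div_mul_cancel₀ _ (by positivity), min_self, condNum, condNum]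
  field_simp
  ring

theorem le_condNum_gram (hQ : Q.PosSemidef) (hW : W.PosSemidef) (hQ0 : Q ≠ 0) (hW0 : W ≠ 0)
    (hQz : 0 ∈ spectrum ℝ Q) (hWz : 0 ∈ spectrum ℝ W) {γ : ℝ} (hγ : γ ≠ 0) :
    condNum W ^ 2 + condNum Q ≤ condNum (bigB m Q + γ ^ 2 • bigW d (W * W)) := by
  have hlQ := lamMinPos_pos hQ hQ0
  have hlW := lamMinPos_pos hW hW0
  have hmin : 0 < min (lamMinPos Q) (γ ^ 2 * lamMinPos W ^ 2) := lt_min hlQ (by positivity)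
  rw [condNum, condNum, condNum, lamMax_gram hQ hW hQ0 hW0,
    lamMinPos_gram hQ hW hQ0 hW0 hQz hWz hγ, add_div, add_comm, div_pow]
  refine add_le_add (div_le_div_of_nonneg_left (lamMax_pos hQ hQ0).le hmin (min_le_left _ _)) ?_
  calc lamMax W ^ 2 / lamMinPos W ^ 2
      = γ ^ 2 * lamMax W ^ 2 / (γ ^ 2 * lamMinPos W ^ 2) := by field_simp
    _ ≤ _ := div_le_div_of_nonneg_left (by positivity) hmin (min_le_right _ _)

end Gram

/-! ### Bregman divergences -/

section Bregman

variable {E : Type*} [NormedAddCommGroup E] [InnerProductSpace ℝ E]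

/-- The quadratic bounds that express `μ`-strong convexity and `L`-smoothness of `f`, for a
function `g` in the role of the gradient. -/
structure QuadraticBounds (μ L : ℝ) (f : E → ℝ) (g : E → E) : Prop where
  lower : ∀ x y, f x + inner ℝ (g x) (y - x) + μ / 2 * ‖y - x‖ ^ 2 ≤ f y
  upper : ∀ x y, f y ≤ f x + inner ℝ (g x) (y - x) + L / 2 * ‖y - x‖ ^ 2

/-- The Bregman divergence of `f` at `z` with respect to `x`, where `g` is the gradient of `f`. -/
noncomputable def bregman (f : E → ℝ) (g : E → E) (x z : E) : ℝ :=
  f z - f x - inner ℝ (g x) (z - x)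

theorem bregman_self (f : E → ℝ) (g : E → E) (x : E) : bregman f g x x = 0 := by
  rw [bregman, sub_self, sub_self, inner_zero_right, sub_zero]

namespace QuadraticBounds

variable {μ L : ℝ} {f : E → ℝ} {g : E → E}

theorem bregman_nonneg (h : QuadraticBounds μ L f g) (hμ : 0 ≤ μ) (x z : E) :
    0 ≤ bregman f g x z := by
  have hlower := h.lower x z
  have hquad : 0 ≤ μ / 2 * ‖z - x‖ ^ 2 := by positivity
  rw [bregman]
  linarith

theorem bregman_le (h : QuadraticBounds μ L f g) (x z : E) :
    bregman f g x z ≤ L / 2 * ‖z - x‖ ^ 2 := by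
  have hupper := h.upper x z
  rw [bregman]
  linarith

/-- `bregman f g x` differs from `f` by an affine function. -/
theorem quadraticBounds_bregman (h : QuadraticBounds μ L f g) (x : E) :
    QuadraticBounds μ L (bregman f g x) (fun z => g z - g x) := by
  constructor
  all_goals
    intro z w
    have hlower := h.lower z w
    have hupper := h.upper z w
    have hsplit : inner ℝ (g x) (w - z) = inner ℝ (g x) (w - x) - inner ℝ (g x) (z - x) := by
      rw [← inner_sub_right, sub_sub_sub_cancel_right]
    simp only [bregman, inner_sub_left]
    linarith

/-- Compare the minimal value `0` of the Bregman divergence with its value after one gradient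
step of length `1 / L`. -/
theorem norm_grad_sub_sq_le (h : QuadraticBounds μ L f g) (hμ : 0 ≤ μ) (hL : 0 < L)
    (x z : E) : ‖g z - g x‖ ^ 2 ≤ 2 * L * bregman f g x z := by
  have hstep := (h.quadraticBounds_bregman x).upper z (z - L⁻¹ • (g z - g x))
  have hnonneg := h.bregman_nonneg hμ x (z - L⁻¹ • (g z - g x))
  rw [sub_sub_cancel_left, inner_neg_right, real_inner_smul_right, norm_neg, norm_smul,
    real_inner_self_eq_norm_sq, mul_pow, Real.norm_eq_abs, sq_abs] at hstep
  have hquad : L / 2 * (L⁻¹ ^ 2 * ‖g z - g x‖ ^ 2) = L⁻¹ / 2 * ‖g z - g x‖ ^ 2 := by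
    field_simp
  calc ‖g z - g x‖ ^ 2 = 2 * L * (L⁻¹ / 2 * ‖g z - g x‖ ^ 2) := by field_simp
    _ ≤ 2 * L * bregman f g x z := mul_le_mul_of_nonneg_left (by linarith) (by positivity)

theorem two_inv_mul_add_smul_le (h : QuadraticBounds μ L f g) {σ : ℝ} (hσ : 0 < σ) (xg v : E) :
    2 * σ⁻¹ * f (xg + σ • v) ≤
      2 * σ⁻¹ * f xg + 2 * inner ℝ (g xg) v + L * σ * ‖v‖ ^ 2 := by
  have hupper := h.upper xg (xg + σ • v)
  rw [add_sub_cancel_left, real_inner_smul_right, norm_smul, mul_pow, Real.norm_eq_abs,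
    sq_abs] at hupper
  calc 2 * σ⁻¹ * f (xg + σ • v)
      ≤ 2 * σ⁻¹ * (f xg + σ * inner ℝ (g xg) v + L / 2 * (σ ^ 2 * ‖v‖ ^ 2)) :=
        mul_le_mul_of_nonneg_left hupper (by positivity)
    _ = 2 * σ⁻¹ * f xg + 2 * inner ℝ (g xg) v + L * σ * ‖v‖ ^ 2 := by field_simp

/-- The estimate behind Nesterov's acceleration: the relation between `τ` and `σ` makes `x` the
point `xg - (σ⁻¹ - 1/2) (xf - xg)`, and strong convexity at `xg` is used towards `z` and `xf`. -/
theorem accelerated_descent (h : QuadraticBounds μ L f g) (hμ : 0 ≤ μ) {σ τ : ℝ} (hσ : 0 < σ)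
    (hσ_le : σ ≤ 1) (hτ : τ * (σ⁻¹ + 1 / 2) = 1) {xg x xf : E}
    (hxg : xg = τ • x + (1 - τ) • xf) (z x' : E) :
    2 * σ⁻¹ * bregman f g z (xg + σ • (x' - x)) ≤
      (2 * σ⁻¹ - 1) * bregman f g z xf - bregman f g z xg + 2 * inner ℝ (g xg - g z) (x' - z)
        - μ * ‖xg - z‖ ^ 2 + L * σ * ‖x' - x‖ ^ 2 := by
  have hD := h.quadraticBounds_bregman z
  have hdescent := hD.two_inv_mul_add_smul_le hσ xg (x' - x)
  have htoward_z : bregman f g z xg + μ / 2 * ‖xg - z‖ ^ 2 ≤ inner ℝ (g xg - g z) (xg - z) := by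
    have hlower := hD.lower xg z
    rw [bregman_self, ← neg_sub xg z, inner_neg_right, norm_neg] at hlower
    linarith
  have htoward_xf : (2 * σ⁻¹ - 1) * inner ℝ (g xg - g z) (xf - xg) ≤
      (2 * σ⁻¹ - 1) * (bregman f g z xf - bregman f g z xg) := by
    have hlower := hD.lower xg xf
    have hquad : 0 ≤ μ / 2 * ‖xf - xg‖ ^ 2 := by positivity
    have hσ_inv : 1 ≤ σ⁻¹ := (one_le_inv₀ hσ).mpr hσ_le
    exact mul_le_mul_of_nonneg_left (by linarith) (by linarith)
  have hx : x - z = (xg - z) - (σ⁻¹ - 1 / 2) • (xf - xg) := by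
    have hxf : xf - xg = τ • (xf - x) := by rw [hxg]; module
    have hcoef : (σ⁻¹ - 1 / 2) * τ = 1 - τ := by linarith
    rw [hxf, smul_smul, hcoef, hxg]
    module
  have hinner_x : inner ℝ (g xg - g z) (x - z) = inner ℝ (g xg - g z) (xg - z)
      - (σ⁻¹ - 1 / 2) * inner ℝ (g xg - g z) (xf - xg) := by
    rw [hx, inner_sub_right, real_inner_smul_right]
  have hinner_diff : inner ℝ (g xg - g z) (x' - x) =
      inner ℝ (g xg - g z) (x' - z) - inner ℝ (g xg - g z) (x - z) := by
    rw [← inner_sub_right, sub_sub_sub_cancel_right]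
  linarith

end QuadraticBounds

end Bregman

/-! ### Primal-dual steps in coordinates centred at the saddle point -/

section PrimalDual

variable {E F : Type*} [NormedAddCommGroup E] [InnerProductSpace ℝ E]
  [NormedAddCommGroup F] [InnerProductSpace ℝ F]

theorem norm_sq_eq_norm_sq_add_two_inner_sub (v w : E) :
    ‖w‖ ^ 2 = ‖v‖ ^ 2 + 2 * inner ℝ (w - v) w - ‖w - v‖ ^ 2 := by
  rw [norm_sub_sq_real, inner_sub_left, real_inner_self_eq_norm_sq, real_inner_comm w v]
  ring

theorem two_inner_sub_le (u v w : E) :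
    2 * inner ℝ (u - v) w ≤ ‖u‖ ^ 2 - ‖v‖ ^ 2 + ‖w - v‖ ^ 2 := by
  have hu := norm_sub_sq_real u w
  have hv := norm_sub_sq_real w v
  rw [real_inner_comm] at hv
  rw [inner_sub_left]
  linarith [sq_nonneg ‖u - w‖]

theorem neg_two_inner_le_norm_sub_sq (v w : E) : -2 * inner ℝ v w ≤ ‖w - v‖ ^ 2 := by
  rw [norm_sub_sq_real, real_inner_comm]
  linarith [sq_nonneg ‖v‖, sq_nonneg ‖w‖]

theorem norm_sub_sq_le_two_mul (v w : E) : ‖v - w‖ ^ 2 ≤ 2 * ‖v‖ ^ 2 + 2 * ‖w‖ ^ 2 := by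
  have hparallelogram := parallelogram_law_with_norm ℝ v w
  nlinarith [sq_nonneg ‖v + w‖]

theorem neg_two_inner_le_weighted (v w : E) {t : ℝ} (ht : 0 < t) :
    -2 * inner ℝ v w ≤ t * ‖v‖ ^ 2 + t⁻¹ * ‖w‖ ^ 2 := by
  have hsq : 0 ≤ t⁻¹ * ‖t • v + w‖ ^ 2 := by positivity
  have hexpand : t⁻¹ * ‖t • v + w‖ ^ 2 = t * ‖v‖ ^ 2 + 2 * inner ℝ v w + t⁻¹ * ‖w‖ ^ 2 := by
    rw [norm_add_sq_real, norm_smul, mul_pow, real_inner_smul_left, Real.norm_eq_abs, sq_abs]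
    field_simp
  linarith

theorem neg_two_inner_map_le {A : E →ₗ[ℝ] F} {Λ : ℝ} (hA : ∀ x, ‖A x‖ ^ 2 ≤ Λ * ‖x‖ ^ 2)
    {a b : ℝ} (hb : 0 < b) (hab : 4 * Λ ≤ a * b) (x : E) (y : F) :
    -2 * inner ℝ (A x) y ≤ a / 2 * ‖x‖ ^ 2 + b / 2 * ‖y‖ ^ 2 := by
  have hweighted := neg_two_inner_le_weighted (A x) y (t := 2 / b) (by positivity)
  have hAx : 2 / b * ‖A x‖ ^ 2 ≤ a / 2 * ‖x‖ ^ 2 := by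
    calc 2 / b * ‖A x‖ ^ 2 ≤ 2 / b * (Λ * ‖x‖ ^ 2) :=
          mul_le_mul_of_nonneg_left (hA _) (by positivity)
      _ = 4 * Λ / (2 * b) * ‖x‖ ^ 2 := by field_simp; ring
      _ ≤ a * b / (2 * b) * ‖x‖ ^ 2 := by gcongr
      _ = a / 2 * ‖x‖ ^ 2 := by field_simp
  rw [inv_div] at hweighted
  linarith

theorem norm_adjoint_sq_le {A : E →ₗ[ℝ] F} {At : F →ₗ[ℝ] E}
    (hadj : ∀ x y, inner ℝ (A x) y = inner ℝ x (At y)) {Λ : ℝ} (hΛ : 0 ≤ Λ)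
    (hA : ∀ x, ‖A x‖ ^ 2 ≤ Λ * ‖x‖ ^ 2) (y : F) : ‖At y‖ ^ 2 ≤ Λ * ‖y‖ ^ 2 := by
  have hcauchy : ‖At y‖ ^ 2 ≤ ‖A (At y)‖ * ‖y‖ := by
    rw [← real_inner_self_eq_norm_sq, ← hadj]
    exact real_inner_le_norm _ _
  rcases (sq_nonneg ‖At y‖).eq_or_lt with hzero | hpos
  · rw [← hzero]
    positivity
  refine le_of_mul_le_mul_left ?_ hpos
  calc ‖At y‖ ^ 2 * ‖At y‖ ^ 2 ≤ (‖A (At y)‖ * ‖y‖) * (‖A (At y)‖ * ‖y‖) := by gcongr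
    _ = ‖A (At y)‖ ^ 2 * ‖y‖ ^ 2 := by ring
    _ ≤ Λ * ‖At y‖ ^ 2 * ‖y‖ ^ 2 := by gcongr; exact hA _
    _ = ‖At y‖ ^ 2 * (Λ * ‖y‖ ^ 2) := by ring

theorem primal_step_le {A : E →ₗ[ℝ] F} {At : F →ₗ[ℝ] E}
    (hadj : ∀ x y, inner ℝ (A x) y = inner ℝ x (At y))
    {Λ : ℝ} (hA : ∀ x, ‖A x‖ ^ 2 ≤ Λ * ‖x‖ ^ 2) {a μ β : ℝ} (hμ : 0 ≤ μ) (hβ : 0 ≤ β)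
    {x x' xg v : E} {w : F}
    (hx' : a • (x' - x) = (μ / 2) • (xg - x) - β • At (A x) - (v + At w)) :
    a * ‖x'‖ ^ 2 ≤ (a - μ / 2) * ‖x‖ ^ 2 + μ / 2 * ‖xg‖ ^ 2
      - (a - μ / 2 - β * Λ) * ‖x' - x‖ ^ 2 - 2 * inner ℝ v x' - 2 * inner ℝ w (A x') := by
  have hadj' : ∀ y z, inner ℝ (At y) z = inner ℝ y (A z) := fun y z => by
    rw [real_inner_comm, ← hadj, real_inner_comm]
  have hupdate : a * inner ℝ (x' - x) x' =
      μ / 2 * inner ℝ (xg - x) x' - β * inner ℝ (A x) (A x') - inner ℝ v x'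
        - inner ℝ w (A x') := by
    rw [← real_inner_smul_left, hx']
    simp only [inner_sub_left, inner_add_left, real_inner_smul_left, hadj']
    ring
  have hincrement := congrArg (a * ·) (norm_sq_eq_norm_sq_add_two_inner_sub x x')
  have hmomentum := mul_le_mul_of_nonneg_left (two_inner_sub_le xg x x') (div_nonneg hμ zero_le_two)
  have hpenalty : β * (-2 * inner ℝ (A x) (A x')) ≤ β * (Λ * ‖x' - x‖ ^ 2) := by
    refine mul_le_mul_of_nonneg_left ((neg_two_inner_le_norm_sub_sq _ _).trans ?_) hβ
    exact map_sub A x' x ▸ hA (x' - x)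
  linarith

theorem dual_step_le {A : E →ₗ[ℝ] F} {At : F →ₗ[ℝ] E}
    (hadj : ∀ x y, inner ℝ (A x) y = inner ℝ x (At y))
    {Λ : ℝ} (hAt : ∀ y, ‖At y‖ ^ 2 ≤ Λ * ‖y‖ ^ 2) {b β : ℝ} (hβ : 0 ≤ β)
    {x' v : E} {y y' : F} (hy' : b • (y' - y) = A x' - β • A (At y + v)) :
    b * ‖y'‖ ^ 2 + β * ‖At y'‖ ^ 2 ≤ b * ‖y‖ ^ 2 - (b - 2 * β * Λ) * ‖y' - y‖ ^ 2
      + 2 * inner ℝ (A x') y' + 2 * β * ‖v‖ ^ 2 := by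
  have hupdate : b * inner ℝ (y' - y) y' =
      inner ℝ (A x') y' - β * inner ℝ (At y + v) (At y') := by
    rw [← real_inner_smul_left, hy', inner_sub_left, real_inner_smul_left, hadj (At y + v)]
  have hincrement := congrArg (b * ·) (norm_sq_eq_norm_sq_add_two_inner_sub y y')
  have hpenalty : -2 * inner ℝ (At y + v) (At y') ≤
      2 * (Λ * ‖y' - y‖ ^ 2) + 2 * ‖v‖ ^ 2 - ‖At y'‖ ^ 2 := by
    have hexpand := norm_sub_sq_real (At y') (At y + v)
    have hdiff : At y' - (At y + v) = At (y' - y) - v := by rw [map_sub, sub_sub]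
    rw [hdiff, real_inner_comm] at hexpand
    linarith [norm_sub_sq_le_two_mul (At (y' - y)) v, hAt (y' - y), sq_nonneg ‖At y + v‖]
  have hpenalty_mul := mul_le_mul_of_nonneg_left hpenalty hβ
  linarith

/-- Extrapolating the dual variable turns the bilinear terms into a telescoping sum, up to
quadratic terms in the increments. -/
theorem extrapolated_coupling_le {A : E →ₗ[ℝ] F} {Λ : ℝ} (hA : ∀ x, ‖A x‖ ^ 2 ≤ Λ * ‖x‖ ^ 2)
    {a b θ : ℝ} (ha : 0 ≤ a) (hb : 0 < b) (hab : 4 * Λ ≤ a * b) (hθ : 0 ≤ θ) (hθ1 : θ ≤ 1)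
    (x x' : E) (y y' yp : F) :
    2 * inner ℝ (A x') y' - 2 * inner ℝ (y + θ • (y - yp)) (A x') ≤
      2 * inner ℝ (A x') (y' - y) - 2 * θ * inner ℝ (A x) (y - yp)
        + a / 2 * ‖x' - x‖ ^ 2 + θ * (b / 2) * ‖y - yp‖ ^ 2 := by
  have hcross := mul_le_mul_of_nonneg_left (neg_two_inner_map_le hA hb hab (x' - x) (y - yp)) hθ
  have hprimal : θ * (a / 2 * ‖x' - x‖ ^ 2) ≤ a / 2 * ‖x' - x‖ ^ 2 :=
    mul_le_of_le_one_left (by positivity) hθ1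
  rw [map_sub, inner_sub_left] at hcross
  rw [inner_add_left, real_inner_smul_left, real_inner_comm (A x') y,
    real_inner_comm (A x') (y - yp), inner_sub_right (A x') y' y]
  linarith

end PrimalDual

/-! ### Linear convergence of APDG -/

section MatrixBounds

variable {ι κ ν : Type*} [Fintype ι] [DecidableEq ι]

theorem inner_toEuclideanLin_left [Fintype κ] [DecidableEq κ] (A : Matrix κ ι ℝ)
    (x : EuclideanSpace ℝ ι) (y : EuclideanSpace ℝ κ) :
    inner ℝ (A.toEuclideanLin x) y = inner ℝ x (Aᵀ.toEuclideanLin y) := by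
  rw [← Matrix.conjTranspose_eq_transpose_of_trivial,
    Matrix.toEuclideanLin_conjTranspose_eq_adjoint, LinearMap.adjoint_inner_right]

theorem norm_sq_eq_dotProduct [Fintype κ] (x : EuclideanSpace ℝ κ) :
    ‖x‖ ^ 2 = x.ofLp ⬝ᵥ x.ofLp := by
  simp only [EuclideanSpace.real_norm_sq_eq, dotProduct, ← sq]

theorem norm_toEuclideanLin_sq [Fintype κ] (A : Matrix κ ι ℝ) (x : EuclideanSpace ℝ ι) :
    ‖A.toEuclideanLin x‖ ^ 2 = x.ofLp ⬝ᵥ ((Aᵀ * A) *ᵥ x.ofLp) := by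
  rw [norm_sq_eq_dotProduct, Matrix.toLpLin_apply, ← Matrix.mulVec_mulVec,
    Matrix.dotProduct_mulVec _ Aᵀ, Matrix.vecMul_transpose]

theorem toEuclideanLin_mul_apply [Fintype ν] [DecidableEq ν] (A : Matrix κ ι ℝ)
    (B : Matrix ι ν ℝ) (x : EuclideanSpace ℝ ν) :
    (A * B).toEuclideanLin x = A.toEuclideanLin (B.toEuclideanLin x) := by
  simp only [Matrix.toLpLin_apply, Matrix.mulVec_mulVec]

end MatrixBounds

section SingularBounds

variable {ι κ : Type} [Fintype ι] [DecidableEq ι] [Fintype κ] [DecidableEq κ]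

/-- The squares of the nonzero singular values of `A` lie in `[l, Λ]`, expressed through the
quadratic forms of `A` and `Aᵀ`. -/
structure SingularBounds (A : Matrix κ ι ℝ) (l Λ : ℝ) : Prop where
  norm_sq_le : ∀ x, ‖A.toEuclideanLin x‖ ^ 2 ≤ Λ * ‖x‖ ^ 2
  norm_transpose_sq_le : ∀ y, ‖Aᵀ.toEuclideanLin y‖ ^ 2 ≤ Λ * ‖y‖ ^ 2
  le_norm_transpose_sq : ∀ y ∈ A.toEuclideanLin.range, l * ‖y‖ ^ 2 ≤ ‖Aᵀ.toEuclideanLin y‖ ^ 2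

theorem singularBounds_lamMinPos_lamMax (A : Matrix κ ι ℝ) :
    SingularBounds A (lamMinPos (Aᵀ * A)) (lamMax (Aᵀ * A)) := by
  have hpsd := posSemidef_transpose_mul_self A
  have hA : ∀ x, ‖A.toEuclideanLin x‖ ^ 2 ≤ lamMax (Aᵀ * A) * ‖x‖ ^ 2 := fun x => by
    rw [norm_toEuclideanLin_sq, norm_sq_eq_dotProduct]
    exact dotProduct_mulVec_le_lamMax_mul hpsd.1 _
  refine ⟨hA, norm_adjoint_sq_le (inner_toEuclideanLin_left A) (lamMax_nonneg hpsd) hA, ?_⟩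
  rintro - ⟨z, rfl⟩
  rw [← toEuclideanLin_mul_apply, norm_toEuclideanLin_sq A, norm_sq_eq_dotProduct,
    Matrix.toLpLin_apply]
  exact lamMinPos_mul_dotProduct_mulVec_le hpsd _

end SingularBounds

section Convergence

variable {ι κ : Type} [Fintype ι] [DecidableEq ι] [Fintype κ] [DecidableEq κ]

/-- The optimality conditions of `min_x max_y f x + ⟨y, A x⟩`, where `g` is the gradient of `f`,
together with the normalization `ys ∈ range A`. -/
structure IsSaddlePoint (A : Matrix κ ι ℝ) (g : EuclideanSpace ℝ ι → EuclideanSpace ℝ ι)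
    (xs : EuclideanSpace ℝ ι) (ys : EuclideanSpace ℝ κ) : Prop where
  map_eq_zero : A.toEuclideanLin xs = 0
  mem_range : ys ∈ A.toEuclideanLin.range
  transpose_map_eq : Aᵀ.toEuclideanLin ys = -g xs

/-- Relations between the parameters of APDG that make its energy contract by the factor `θ`,
for a constraint matrix `A` whose Gram matrix has its nonzero eigenvalues in `[l, Λ]`. -/
structure APDGParams.Contractive (c : APDGParams) (μ L l Λ : ℝ) : Prop where
  ηx_pos : 0 < c.ηx
  ηy_pos : 0 < c.ηy
  αx_eq : c.αx = μ / 2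
  βx_nonneg : 0 ≤ c.βx
  βy_nonneg : 0 ≤ c.βy
  σx_pos : 0 < c.σx
  σx_le : c.σx ≤ 1
  τx_mul : c.τx * (c.σx⁻¹ + 1 / 2) = 1
  θ_nonneg : 0 ≤ c.θ
  θ_le : c.θ ≤ 1
  primal : μ / 2 + c.βx * Λ + L * c.σx ≤ c.ηx⁻¹ / 2
  dual : 4 * c.βy * Λ ≤ c.ηy⁻¹
  grad : 4 * c.βy * L ≤ 1
  coupling : 4 * Λ ≤ c.ηx⁻¹ * c.ηy⁻¹
  rate_x : c.ηx⁻¹ - μ / 2 ≤ c.θ * c.ηx⁻¹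
  rate_f : 2 * c.σx⁻¹ - 1 ≤ c.θ * (2 * c.σx⁻¹)
  rate_y : c.ηy⁻¹ ≤ c.θ * (c.ηy⁻¹ + c.βy * l)

/-- The point `x_g^k` at which APDG evaluates the gradient. -/
def APDGParams.gradPoint {E F : Type} [AddCommGroup E] [Module ℝ E] (c : APDGParams)
    (s : APDGState E F) : E :=
  c.τx • s.x + (1 - c.τx) • s.xf

/-- The extrapolated dual variable `y_m^k` of APDG. -/
def APDGParams.extrapolatedDual {E F : Type} [AddCommGroup F] [Module ℝ F] (c : APDGParams)
    (s : APDGState E F) : F :=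
  s.y + c.θ • (s.y - s.yPrev)

/-- The Lyapunov function of APDG relative to the saddle point `(xs, ys)`. The cross term
compensates for the extrapolation of the dual variable. -/
noncomputable def energy (A : Matrix κ ι ℝ) (f : EuclideanSpace ℝ ι → ℝ)
    (g : EuclideanSpace ℝ ι → EuclideanSpace ℝ ι) (c : APDGParams) (l : ℝ)
    (xs : EuclideanSpace ℝ ι) (ys : EuclideanSpace ℝ κ)
    (s : APDGState (EuclideanSpace ℝ ι) (EuclideanSpace ℝ κ)) : ℝ :=
  c.ηx⁻¹ * ‖s.x - xs‖ ^ 2 + 2 * c.σx⁻¹ * bregman f g xs s.xf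
    + (c.ηy⁻¹ + c.βy * l) * ‖s.y - ys‖ ^ 2 + c.ηy⁻¹ / 2 * ‖s.y - s.yPrev‖ ^ 2
    - 2 * inner ℝ (A.toEuclideanLin (s.x - xs)) (s.y - s.yPrev)

variable {A : Matrix κ ι ℝ} {μ L l Λ : ℝ} {f : EuclideanSpace ℝ ι → ℝ}
  {g : EuclideanSpace ℝ ι → EuclideanSpace ℝ ι} {c : APDGParams}
  {xs : EuclideanSpace ℝ ι} {ys : EuclideanSpace ℝ κ}
  {s s' : APDGState (EuclideanSpace ℝ ι) (EuclideanSpace ℝ κ)}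

theorem apdgStep_x_sub (hηx : c.ηx ≠ 0) (hs' : s' = apdgStep A g c s) :
    c.ηx⁻¹ • (s'.x - s.x) = c.αx • (c.gradPoint s - s.x)
      - c.βx • Aᵀ.toEuclideanLin (A.toEuclideanLin s.x)
      - (g (c.gradPoint s) + Aᵀ.toEuclideanLin (c.extrapolatedDual s)) := by
  rw [inv_smul_eq_iff₀ hηx, hs']
  simp only [apdgStep, APDGParams.gradPoint, APDGParams.extrapolatedDual]
  module

theorem apdgStep_y_sub (hηy : c.ηy ≠ 0) (hs' : s' = apdgStep A g c s) :
    c.ηy⁻¹ • (s'.y - s.y) = A.toEuclideanLin s'.x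
      - c.βy • A.toEuclideanLin (Aᵀ.toEuclideanLin s.y + g (c.gradPoint s)) := by
  rw [inv_smul_eq_iff₀ hηy, hs']
  simp only [apdgStep, APDGParams.gradPoint]
  module

theorem apdgStep_y_mem_range (hy : s.y ∈ A.toEuclideanLin.range) :
    (apdgStep A g c s).y ∈ A.toEuclideanLin.range := by
  refine Submodule.add_mem _ (Submodule.sub_mem _ hy ?_) ?_
  all_goals exact Submodule.smul_mem _ _ ⟨_, rfl⟩

theorem apdg_y_mem_range {y₀ : EuclideanSpace ℝ κ} (hy₀ : y₀ ∈ A.toEuclideanLin.range)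
    (x₀ : EuclideanSpace ℝ ι) (N : ℕ) : (apdg A g c x₀ y₀ N).y ∈ A.toEuclideanLin.range := by
  induction N with
  | zero => exact hy₀
  | succ N ih => exact apdgStep_y_mem_range ih

theorem apdgStep_primal_le (hc : c.Contractive μ L l Λ) (hμ : 0 ≤ μ)
    (hf : QuadraticBounds μ L f g) (hA : SingularBounds A l Λ) (hsaddle : IsSaddlePoint A g xs ys)
    (hs' : s' = apdgStep A g c s) :
    c.ηx⁻¹ * ‖s'.x - xs‖ ^ 2 + 2 * c.σx⁻¹ * bregman f g xs s'.xf
        + c.ηx⁻¹ / 2 * ‖s'.x - s.x‖ ^ 2 ≤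
      (c.ηx⁻¹ - μ / 2) * ‖s.x - xs‖ ^ 2 + (2 * c.σx⁻¹ - 1) * bregman f g xs s.xf
        - bregman f g xs (c.gradPoint s)
        - 2 * inner ℝ (c.extrapolatedDual s - ys) (A.toEuclideanLin (s'.x - xs)) := by
  have hupdate : c.ηx⁻¹ • (s'.x - xs - (s.x - xs)) =
      (μ / 2) • (c.gradPoint s - xs - (s.x - xs))
        - c.βx • Aᵀ.toEuclideanLin (A.toEuclideanLin (s.x - xs))
        - (g (c.gradPoint s) - g xs + Aᵀ.toEuclideanLin (c.extrapolatedDual s - ys)) := by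
    rw [sub_sub_sub_cancel_right, sub_sub_sub_cancel_right, apdgStep_x_sub hc.ηx_pos.ne' hs',
      hc.αx_eq, map_sub, map_sub _ _ ys, hsaddle.map_eq_zero, hsaddle.transpose_map_eq, sub_zero]
    abel
  have hstep := primal_step_le (inner_toEuclideanLin_left A) hA.norm_sq_le hμ hc.βx_nonneg hupdate
  have hdescent := hf.accelerated_descent hμ hc.σx_pos hc.σx_le hc.τx_mul
    (xg := c.gradPoint s) rfl xs s'.x
  have hxf : s'.xf = c.gradPoint s + c.σx • (s'.x - s.x) := by rw [hs']; rfl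
  rw [sub_sub_sub_cancel_right] at hstep
  rw [← hxf] at hdescent
  have hincrement := mul_le_mul_of_nonneg_right hc.primal (sq_nonneg ‖s'.x - s.x‖)
  have hgradPoint : 0 ≤ μ * ‖c.gradPoint s - xs‖ ^ 2 := by positivity
  linarith

theorem apdgStep_dual_le (hc : c.Contractive μ L l Λ) (hμ : 0 ≤ μ) (hL : 0 < L)
    (hf : QuadraticBounds μ L f g) (hA : SingularBounds A l Λ) (hsaddle : IsSaddlePoint A g xs ys)
    (hs' : s' = apdgStep A g c s) (hy : s.y ∈ A.toEuclideanLin.range) :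
    (c.ηy⁻¹ + c.βy * l) * ‖s'.y - ys‖ ^ 2 + c.ηy⁻¹ / 2 * ‖s'.y - s.y‖ ^ 2 ≤
      c.ηy⁻¹ * ‖s.y - ys‖ ^ 2 + 2 * inner ℝ (A.toEuclideanLin (s'.x - xs)) (s'.y - ys)
        + bregman f g xs (c.gradPoint s) := by
  have hupdate : c.ηy⁻¹ • (s'.y - ys - (s.y - ys)) = A.toEuclideanLin (s'.x - xs)
      - c.βy • A.toEuclideanLin
        (Aᵀ.toEuclideanLin (s.y - ys) + (g (c.gradPoint s) - g xs)) := by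
    rw [sub_sub_sub_cancel_right, apdgStep_y_sub hc.ηy_pos.ne' hs', map_sub _ _ xs,
      hsaddle.map_eq_zero, sub_zero, map_sub _ _ ys, hsaddle.transpose_map_eq, sub_neg_eq_add,
      add_assoc, add_sub_cancel]
  have hstep := dual_step_le (inner_toEuclideanLin_left A) hA.norm_transpose_sq_le hc.βy_nonneg
    hupdate
  rw [sub_sub_sub_cancel_right] at hstep
  have hrange : s'.y - ys ∈ A.toEuclideanLin.range :=
    Submodule.sub_mem _ (hs' ▸ apdgStep_y_mem_range hy) hsaddle.mem_range
  have hpenalty := mul_le_mul_of_nonneg_left (hA.le_norm_transpose_sq _ hrange) hc.βy_nonneg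
  have hincrement := mul_le_mul_of_nonneg_right hc.dual (sq_nonneg ‖s'.y - s.y‖)
  have hgrad := mul_le_mul_of_nonneg_left (hf.norm_grad_sub_sq_le hμ hL xs (c.gradPoint s))
    hc.βy_nonneg
  have hbregman := mul_le_mul_of_nonneg_right hc.grad (hf.bregman_nonneg hμ xs (c.gradPoint s))
  linarith

theorem energy_apdgStep_le (hc : c.Contractive μ L l Λ) (hμ : 0 ≤ μ) (hL : 0 < L)
    (hf : QuadraticBounds μ L f g) (hA : SingularBounds A l Λ) (hsaddle : IsSaddlePoint A g xs ys)
    (hy : s.y ∈ A.toEuclideanLin.range) :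
    energy A f g c l xs ys (apdgStep A g c s) ≤ c.θ * energy A f g c l xs ys s := by
  obtain ⟨s', hs'⟩ : ∃ s', s' = apdgStep A g c s := ⟨_, rfl⟩
  have hprimal := apdgStep_primal_le hc hμ hf hA hsaddle hs'
  have hdual := apdgStep_dual_le hc hμ hL hf hA hsaddle hs' hy
  have hcoupling := extrapolated_coupling_le hA.norm_sq_le (inv_pos.mpr hc.ηx_pos).le
    (inv_pos.mpr hc.ηy_pos) hc.coupling hc.θ_nonneg hc.θ_le
    (s.x - xs) (s'.x - xs) (s.y - ys) (s'.y - ys) (s.yPrev - ys)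
  have hextrapolated : s.y - ys + c.θ • (s.y - s.yPrev) = c.extrapolatedDual s - ys :=
    sub_add_eq_add_sub _ _ _
  simp only [sub_sub_sub_cancel_right, hextrapolated] at hcoupling
  have hrate_x := mul_le_mul_of_nonneg_right hc.rate_x (sq_nonneg ‖s.x - xs‖)
  have hrate_f := mul_le_mul_of_nonneg_right hc.rate_f (hf.bregman_nonneg hμ xs s.xf)
  have hrate_y := mul_le_mul_of_nonneg_right hc.rate_y (sq_nonneg ‖s.y - ys‖)
  have hyPrev : s'.yPrev = s.y := by rw [hs']; rfl
  rw [← hs', energy, energy, hyPrev]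
  linarith

theorem energy_apdg_le (hc : c.Contractive μ L l Λ) (hμ : 0 ≤ μ) (hL : 0 < L)
    (hf : QuadraticBounds μ L f g) (hA : SingularBounds A l Λ) (hsaddle : IsSaddlePoint A g xs ys)
    (x₀ : EuclideanSpace ℝ ι) {y₀ : EuclideanSpace ℝ κ} (hy₀ : y₀ ∈ A.toEuclideanLin.range)
    (N : ℕ) :
    energy A f g c l xs ys (apdg A g c x₀ y₀ N) ≤
      c.θ ^ N * energy A f g c l xs ys (APDGState.init x₀ y₀) := by
  induction N with
  | zero => rw [pow_zero, one_mul, apdg]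
  | succ N ih =>
    calc energy A f g c l xs ys (apdg A g c x₀ y₀ (N + 1))
        ≤ c.θ * energy A f g c l xs ys (apdg A g c x₀ y₀ N) :=
          energy_apdgStep_le hc hμ hL hf hA hsaddle (apdg_y_mem_range hy₀ x₀ N)
      _ ≤ c.θ * (c.θ ^ N * energy A f g c l xs ys (APDGState.init x₀ y₀)) :=
          mul_le_mul_of_nonneg_left ih hc.θ_nonneg
      _ = c.θ ^ (N + 1) * energy A f g c l xs ys (APDGState.init x₀ y₀) := by
          rw [pow_succ', mul_assoc]

theorem energy_init_le {κ : Type} [Fintype κ] {A : Matrix κ ι ℝ} {ys : EuclideanSpace ℝ κ}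
    (hσx : 0 ≤ c.σx) (hf : QuadraticBounds μ L f g) (x₀ : EuclideanSpace ℝ ι)
    (y₀ : EuclideanSpace ℝ κ) :
    energy A f g c l xs ys (APDGState.init x₀ y₀) ≤
      (c.ηx⁻¹ + L * c.σx⁻¹) * ‖x₀ - xs‖ ^ 2 + (c.ηy⁻¹ + c.βy * l) * ‖y₀ - ys‖ ^ 2 := by
  have hbregman := mul_le_mul_of_nonneg_left (hf.bregman_le xs x₀) (a := 2 * c.σx⁻¹) (by positivity)
  simp only [energy, APDGState.init, sub_self, norm_zero, inner_zero_right]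
  linarith

theorem le_energy (hc : c.Contractive μ L l Λ) (hμ : 0 ≤ μ) (hl : 0 ≤ l)
    (hf : QuadraticBounds μ L f g) (hA : SingularBounds A l Λ)
    (s : APDGState (EuclideanSpace ℝ ι) (EuclideanSpace ℝ κ)) :
    c.ηx⁻¹ / 2 * ‖s.x - xs‖ ^ 2 ≤ energy A f g c l xs ys s := by
  have hηy := hc.ηy_pos
  have hσx := hc.σx_pos
  have hβy := hc.βy_nonneg
  have hcross := neg_two_inner_map_le hA.norm_sq_le (inv_pos.mpr hηy) hc.coupling (s.x - xs)
    (-(s.y - s.yPrev))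
  rw [inner_neg_right, norm_neg] at hcross
  have hbregman : 0 ≤ 2 * c.σx⁻¹ * bregman f g xs s.xf :=
    mul_nonneg (by positivity) (hf.bregman_nonneg hμ xs s.xf)
  have hdual : 0 ≤ (c.ηy⁻¹ + c.βy * l) * ‖s.y - ys‖ ^ 2 := by positivity
  rw [energy]
  linarith

theorem norm_apdg_sub_sq_le (hc : c.Contractive μ L l Λ) (hμ : 0 ≤ μ) (hL : 0 < L) (hl : 0 ≤ l)
    (hf : QuadraticBounds μ L f g) (hA : SingularBounds A l Λ) (hsaddle : IsSaddlePoint A g xs ys)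
    (x₀ : EuclideanSpace ℝ ι) {y₀ : EuclideanSpace ℝ κ} (hy₀ : y₀ ∈ A.toEuclideanLin.range)
    (N : ℕ) :
    c.ηx⁻¹ / 2 * ‖(apdg A g c x₀ y₀ N).x - xs‖ ^ 2 ≤
      c.θ ^ N * ((c.ηx⁻¹ + L * c.σx⁻¹) * ‖x₀ - xs‖ ^ 2
        + (c.ηy⁻¹ + c.βy * l) * ‖y₀ - ys‖ ^ 2) :=
  calc c.ηx⁻¹ / 2 * ‖(apdg A g c x₀ y₀ N).x - xs‖ ^ 2
      ≤ energy A f g c l xs ys (apdg A g c x₀ y₀ N) := le_energy hc hμ hl hf hA _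
    _ ≤ c.θ ^ N * energy A f g c l xs ys (APDGState.init x₀ y₀) :=
        energy_apdg_le hc hμ hL hf hA hsaddle x₀ hy₀ N
    _ ≤ _ := mul_le_mul_of_nonneg_left (energy_init_le hc.σx_pos.le hf x₀ y₀)
        (pow_nonneg hc.θ_nonneg N)

end Convergence

/-! ### The choice of the parameters -/

/-- The number `max {√χ √(L/μ), χ}`, `χ = u / l`, that governs the rate of convergence. -/
noncomputable def rateNum (μ L l u : ℝ) : ℝ := max (√(u / l) * √(L / μ)) (u / l)

/-- The parameters of APDG computed from `μ`, `L` and the extreme nonzero eigenvalues `l`, `u` of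
the Gram matrix of the constraints. -/
noncomputable def apdgRule (μ L l u : ℝ) : APDGParams where
  ηx := (4 * μ * rateNum μ L l u)⁻¹
  ηy := (2 * l * rateNum μ L l u / L)⁻¹
  αx := μ / 2
  βx := μ * rateNum μ L l u / (2 * u)
  βy := 1 / (4 * L)
  τx := ((u / l / rateNum μ L l u)⁻¹ + 1 / 2)⁻¹
  τy := 1
  σx := u / l / rateNum μ L l u
  σy := 1
  θ := 1 - 1 / (16 * rateNum μ L l u)

section Rule

variable {μ L l u : ℝ}

theorem div_le_rateNum (μ L l u : ℝ) : u / l ≤ rateNum μ L l u := le_max_right _ _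

theorem one_le_rateNum (hl : 0 < l) (hu : l ≤ u) : 1 ≤ rateNum μ L l u :=
  ((one_le_div hl).mpr hu).trans (div_le_rateNum _ _ _ _)

theorem mul_le_rateNum_sq_mul (hμ : 0 < μ) (hL : μ ≤ L) (hl : 0 < l) (hu : l ≤ u) :
    u * L ≤ rateNum μ L l u ^ 2 * (l * μ) := by
  have hχ : 0 ≤ u / l := div_nonneg (hl.le.trans hu) hl.le
  have hr : 0 ≤ L / μ := div_nonneg (hμ.le.trans hL) hμ.le
  rw [← div_le_iff₀ (by positivity), ← div_mul_div_comm]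
  calc u / l * (L / μ) = (√(u / l) * √(L / μ)) ^ 2 := by
        rw [mul_pow, Real.sq_sqrt hχ, Real.sq_sqrt hr]
    _ ≤ rateNum μ L l u ^ 2 := by gcongr; exact le_max_left _ _

theorem apdgRule_valid (hμ : 0 < μ) (hL : μ ≤ L) (hl : 0 < l) (hu : l ≤ u) :
    (apdgRule μ L l u).Valid := by
  have hκ : 1 ≤ rateNum μ L l u := one_le_rateNum hl hu
  have hχ := div_le_rateNum μ L l u
  have hL0 : 0 < L := hμ.trans_le hL
  have hu0 : 0 < u := hl.trans_le hu
  simp only [APDGParams.Valid, apdgRule]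
  set κ := rateNum μ L l u
  have hκ0 : 0 < κ := by linarith
  have hσ : u / l / κ ≤ 1 := (div_le_one hκ0).mpr hχ
  have hσ0 : 0 < u / l / κ := by positivity
  have hσ_inv : 1 ≤ (u / l / κ)⁻¹ := (one_le_inv₀ hσ0).mpr hσ
  refine ⟨by positivity, by positivity, by positivity, by positivity, by positivity,
    ⟨by positivity, inv_le_one_of_one_le₀ (by linarith)⟩, ⟨one_pos, le_rfl⟩, ⟨hσ0, hσ⟩,
    ⟨one_pos, le_rfl⟩, ?_, ?_⟩
  · rw [sub_pos, div_lt_one (by positivity)]; linarith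
  · rw [sub_lt_self_iff]; positivity

theorem apdgRule_primal (hμ : 0 < μ) (hL : μ ≤ L) (hl : 0 < l) (hu : l ≤ u) :
    μ / 2 + (apdgRule μ L l u).βx * u + L * (apdgRule μ L l u).σx ≤
      (apdgRule μ L l u).ηx⁻¹ / 2 := by
  have hκ : 1 ≤ rateNum μ L l u := one_le_rateNum hl hu
  have hsq := mul_le_rateNum_sq_mul hμ hL hl hu
  have hu0 : 0 < u := hl.trans_le hu
  simp only [apdgRule, inv_inv]
  set κ := rateNum μ L l u
  have hβ : μ * κ / (2 * u) * u = μ * κ / 2 := by field_simp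
  have hσ : L * (u / l / κ) ≤ μ * κ := by
    rw [div_div, ← mul_div_assoc, div_le_iff₀ (by positivity)]
    linarith
  have hμκ : μ ≤ μ * κ := le_mul_of_one_le_right hμ.le hκ
  linarith

theorem apdgRule_dual (hL : 0 < L) (hl : 0 < l) (hu : l ≤ u) :
    4 * (apdgRule μ L l u).βy * u ≤ (apdgRule μ L l u).ηy⁻¹ := by
  have hχ := (div_le_iff₀ hl).mp (div_le_rateNum μ L l u)
  simp only [apdgRule, inv_inv]
  rw [show 4 * (1 / (4 * L)) * u = u / L by field_simp]
  gcongr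
  linarith

theorem apdgRule_coupling (hμ : 0 < μ) (hL : μ ≤ L) (hl : 0 < l) (hu : l ≤ u) :
    4 * u ≤ (apdgRule μ L l u).ηx⁻¹ * (apdgRule μ L l u).ηy⁻¹ := by
  have hsq := mul_le_rateNum_sq_mul hμ hL hl hu
  have hL0 : 0 < L := hμ.trans_le hL
  have hu0 : 0 < u := hl.trans_le hu
  simp only [apdgRule, inv_inv]
  rw [← mul_div_assoc, le_div_iff₀ hL0]
  linarith [mul_pos hu0 hL0]

theorem apdgRule_rate_x (hl : 0 < l) (hu : l ≤ u) (hμ : 0 ≤ μ) :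
    (apdgRule μ L l u).ηx⁻¹ - μ / 2 ≤ (apdgRule μ L l u).θ * (apdgRule μ L l u).ηx⁻¹ := by
  have hκ : 1 ≤ rateNum μ L l u := one_le_rateNum hl hu
  simp only [apdgRule, inv_inv]
  set κ := rateNum μ L l u
  have hθ : (1 - 1 / (16 * κ)) * (4 * μ * κ) = 4 * μ * κ - μ / 4 := by field_simp; ring
  linarith

theorem apdgRule_rate_f (hl : 0 < l) (hu : l ≤ u) :
    2 * (apdgRule μ L l u).σx⁻¹ - 1 ≤
      (apdgRule μ L l u).θ * (2 * (apdgRule μ L l u).σx⁻¹) := by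
  have hκ : 1 ≤ rateNum μ L l u := one_le_rateNum hl hu
  have hu0 : 0 < u := hl.trans_le hu
  simp only [apdgRule]
  set κ := rateNum μ L l u
  have hθ : (1 - 1 / (16 * κ)) * (2 * (u / l / κ)⁻¹) = 2 * (u / l / κ)⁻¹ - l / (8 * u) := by
    field_simp; ring
  have hlu : l / (8 * u) ≤ 1 := by rw [div_le_one (by positivity)]; linarith
  linarith

theorem apdgRule_rate_y (hL : 0 < L) (hl : 0 < l) (hu : l ≤ u) :
    (apdgRule μ L l u).ηy⁻¹ ≤
      (apdgRule μ L l u).θ * ((apdgRule μ L l u).ηy⁻¹ + (apdgRule μ L l u).βy * l) := by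
  have hκ : 1 ≤ rateNum μ L l u := one_le_rateNum hl hu
  simp only [apdgRule, inv_inv]
  set κ := rateNum μ L l u
  have hθ : (1 - 1 / (16 * κ)) * (2 * l * κ / L + 1 / (4 * L) * l)
      = 2 * l * κ / L + l / (8 * L) * (1 - 1 / (8 * κ)) := by field_simp; ring
  have hκ_inv : 1 / (8 * κ) ≤ 1 := by rw [div_le_one (by positivity)]; linarith
  have hgain : 0 ≤ l / (8 * L) * (1 - 1 / (8 * κ)) := mul_nonneg (by positivity) (by linarith)
  linarith

theorem apdgRule_contractive (hμ : 0 < μ) (hL : μ ≤ L) (hl : 0 < l) (hu : l ≤ u) :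
    (apdgRule μ L l u).Contractive μ L l u := by
  obtain ⟨hηx, hηy, -, hβx, hβy, -, -, hσx, -, hθ⟩ := apdgRule_valid hμ hL hl hu
  have hL0 : 0 < L := hμ.trans_le hL
  refine ⟨hηx, hηy, rfl, hβx.le, hβy.le, hσx.1, hσx.2, ?_, hθ.1.le, hθ.2.le,
    apdgRule_primal hμ hL hl hu, apdgRule_dual hL0 hl hu, ?_, apdgRule_coupling hμ hL hl hu,
    apdgRule_rate_x hl hu hμ.le, apdgRule_rate_f hl hu, apdgRule_rate_y hL0 hl hu⟩
  · have hσx_pos := hσx.1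
    exact inv_mul_cancel₀ (by positivity)
  · simp only [apdgRule]
    exact le_of_eq (by field_simp)

theorem apdgRule_theta_pow_le (hl : 0 < l) (hu : l ≤ u) (N : ℕ) :
    (apdgRule μ L l u).θ ^ N ≤ Real.exp (-(N / (32 * rateNum μ L l u))) ^ 2 := by
  have hκ : 1 ≤ rateNum μ L l u := one_le_rateNum hl hu
  have hθ : 0 ≤ 1 - 1 / (16 * rateNum μ L l u) := by
    rw [sub_nonneg, div_le_one (by linarith)]; linarith
  calc (apdgRule μ L l u).θ ^ N ≤ Real.exp (-(1 / (16 * rateNum μ L l u))) ^ N :=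
        pow_le_pow_left₀ hθ (Real.one_sub_le_exp_neg _) N
    _ = Real.exp (-(N / (32 * rateNum μ L l u))) ^ 2 := by
      rw [← Real.exp_nat_mul, ← Real.exp_nat_mul]
      congr 1
      field_simp
      ring

theorem apdgRule_primal_weight_le (hL : 0 ≤ L) (hμL : μ ≤ L) (hl : 0 < l) (hu : l ≤ u) :
    (apdgRule μ L l u).ηx⁻¹ + L * (apdgRule μ L l u).σx⁻¹ ≤ 5 * L * rateNum μ L l u := by
  have hκ : 1 ≤ rateNum μ L l u := one_le_rateNum hl hu
  have hu0 : 0 < u := hl.trans_le hu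
  simp only [apdgRule, inv_inv]
  set κ := rateNum μ L l u
  have hσ : L * (u / l / κ)⁻¹ = L * κ * (l / u) := by field_simp
  have hlu : L * κ * (l / u) ≤ L * κ :=
    mul_le_of_le_one_right (by positivity) ((div_le_one hu0).mpr hu)
  have hμκ : μ * κ ≤ L * κ := by gcongr
  linarith

theorem apdgRule_dual_weight_le (hL : 0 < L) (hl : 0 < l) (hu : l ≤ u) :
    (apdgRule μ L l u).ηy⁻¹ + (apdgRule μ L l u).βy * l ≤ 4 * rateNum μ L l u / L * l := by
  have hκ : 1 ≤ rateNum μ L l u := one_le_rateNum hl hu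
  simp only [apdgRule, inv_inv]
  set κ := rateNum μ L l u
  calc 2 * l * κ / L + 1 / (4 * L) * l = (2 * κ + 1 / 4) / L * l := by field_simp
    _ ≤ 4 * κ / L * l := by gcongr; linarith

end Rule

theorem three_mul_sq_add_two_mul_sq_le {r a b : ℝ} (hr : 1 ≤ r) (ha : 0 ≤ a) (hb : 0 ≤ b) :
    3 * r * a ^ 2 + 2 * b ^ 2 ≤ (2 * r * (a + b)) ^ 2 := by
  have hr_sq : r ≤ r ^ 2 := le_self_pow₀ hr two_ne_zero
  calc 3 * r * a ^ 2 + 2 * b ^ 2 ≤ 4 * r ^ 2 * a ^ 2 + 4 * r ^ 2 * b ^ 2 := by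
        gcongr <;> linarith
    _ ≤ 4 * r ^ 2 * a ^ 2 + 4 * r ^ 2 * b ^ 2 + 8 * r ^ 2 * (a * b) :=
        le_add_of_nonneg_right (by positivity)
    _ = (2 * r * (a + b)) ^ 2 := by ring

section RuleConvergence

variable {ι κ : Type} [Fintype ι] [DecidableEq ι] [Fintype κ] [DecidableEq κ]
  {A : Matrix κ ι ℝ} {μ L l u : ℝ} {f : EuclideanSpace ℝ ι → ℝ}
  {g : EuclideanSpace ℝ ι → EuclideanSpace ℝ ι} {xs : EuclideanSpace ℝ ι}
  {ys : EuclideanSpace ℝ κ}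

theorem norm_apdg_apdgRule_sub_sq_le (hμ : 0 < μ) (hL : μ ≤ L) (hl : 0 < l) (hu : l ≤ u)
    (hf : QuadraticBounds μ L f g) (hA : SingularBounds A l u) (hsaddle : IsSaddlePoint A g xs ys)
    (x₀ : EuclideanSpace ℝ ι) {y₀ : EuclideanSpace ℝ κ} (hy₀ : y₀ ∈ A.toEuclideanLin.range)
    (N : ℕ) :
    ‖(apdg A g (apdgRule μ L l u) x₀ y₀ N).x - xs‖ ^ 2 ≤
      (apdgRule μ L l u).θ ^ N * (3 * (L / μ) * ‖x₀ - xs‖ ^ 2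
        + 2 * ((‖Aᵀ.toEuclideanLin y₀‖ + ‖g xs‖) / μ) ^ 2) := by
  have hL0 : 0 < L := hμ.trans_le hL
  have hκ : 1 ≤ rateNum μ L l u := one_le_rateNum hl hu
  have hc := apdgRule_contractive hμ hL hl hu
  have hsq := norm_apdg_sub_sq_le hc hμ.le hL0 hl.le hf hA hsaddle x₀ hy₀ N
  have hdual : l * ‖y₀ - ys‖ ^ 2 ≤ (‖Aᵀ.toEuclideanLin y₀‖ + ‖g xs‖) ^ 2 := by
    refine (hA.le_norm_transpose_sq _ (Submodule.sub_mem _ hy₀ hsaddle.mem_range)).trans ?_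
    rw [map_sub, hsaddle.transpose_map_eq, sub_neg_eq_add]
    gcongr
    exact norm_add_le _ _
  set R := ‖Aᵀ.toEuclideanLin y₀‖ + ‖g xs‖
  set κ := rateNum μ L l u
  have hprimal_weight : ((apdgRule μ L l u).ηx⁻¹ + L * (apdgRule μ L l u).σx⁻¹) * ‖x₀ - xs‖ ^ 2 ≤
      6 * L * κ * ‖x₀ - xs‖ ^ 2 := by
    refine mul_le_mul_of_nonneg_right ?_ (sq_nonneg _)
    nlinarith [apdgRule_primal_weight_le hL0.le hL hl hu]
  have hdual_weight : ((apdgRule μ L l u).ηy⁻¹ + (apdgRule μ L l u).βy * l) * ‖y₀ - ys‖ ^ 2 ≤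
      4 * κ / μ * R ^ 2 :=
    calc ((apdgRule μ L l u).ηy⁻¹ + (apdgRule μ L l u).βy * l) * ‖y₀ - ys‖ ^ 2
        ≤ 4 * κ / L * l * ‖y₀ - ys‖ ^ 2 :=
          mul_le_mul_of_nonneg_right (apdgRule_dual_weight_le hL0 hl hu) (sq_nonneg _)
      _ = 4 * κ / L * (l * ‖y₀ - ys‖ ^ 2) := mul_assoc _ _ _
      _ ≤ 4 * κ / μ * R ^ 2 := by gcongr
  refine le_of_mul_le_mul_left ?_ (by positivity : 0 < 2 * μ * κ)
  calc 2 * μ * κ * ‖(apdg A g (apdgRule μ L l u) x₀ y₀ N).x - xs‖ ^ 2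
      = (apdgRule μ L l u).ηx⁻¹ / 2 * ‖(apdg A g (apdgRule μ L l u) x₀ y₀ N).x - xs‖ ^ 2 := by
        rw [apdgRule, inv_inv]; ring
    _ ≤ (apdgRule μ L l u).θ ^ N * (6 * L * κ * ‖x₀ - xs‖ ^ 2 + 4 * κ / μ * R ^ 2) :=
        hsq.trans (mul_le_mul_of_nonneg_left (add_le_add hprimal_weight hdual_weight)
          (pow_nonneg hc.θ_nonneg N))
    _ = 2 * μ * κ * ((apdgRule μ L l u).θ ^ N * (3 * (L / μ) * ‖x₀ - xs‖ ^ 2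
        + 2 * (R / μ) ^ 2)) := by field_simp; ring

theorem norm_apdg_apdgRule_sub_le (hμ : 0 < μ) (hL : μ ≤ L) (hl : 0 < l) (hu : l ≤ u)
    (hf : QuadraticBounds μ L f g) (hA : SingularBounds A l u) (hsaddle : IsSaddlePoint A g xs ys)
    (x₀ : EuclideanSpace ℝ ι) {y₀ : EuclideanSpace ℝ κ} (hy₀ : y₀ ∈ A.toEuclideanLin.range)
    (N : ℕ) :
    ‖(apdg A g (apdgRule μ L l u) x₀ y₀ N).x - xs‖ ≤
      Real.exp (-(N / (32 * rateNum μ L l u))) *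
        (2 * (L / μ) * (‖x₀ - xs‖ + (‖Aᵀ.toEuclideanLin y₀‖ + ‖g xs‖) / μ)) := by
  have hL0 : 0 < L := hμ.trans_le hL
  refine le_of_sq_le_sq ?_ (by positivity)
  rw [mul_pow]
  refine (norm_apdg_apdgRule_sub_sq_le hμ hL hl hu hf hA hsaddle x₀ hy₀ N).trans
    (mul_le_mul (apdgRule_theta_pow_le hl hu N) ?_ (by positivity) (sq_nonneg _))
  exact three_mul_sq_add_two_mul_sq_le ((one_le_div hμ).mpr hL) (norm_nonneg _) (by positivity)

end RuleConvergence

theorem le_of_exp_decay {e V ε κ K n : ℝ} (hκ : 0 < κ) (hK : κ ≤ K) (hV : 0 ≤ V) (hε : 0 < ε)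
    (hn : 0 ≤ n) (he : e ≤ Real.exp (-(n / κ)) * V) (h : K * Real.log (V / ε) ≤ n) : e ≤ ε := by
  refine he.trans ?_
  rcases hV.eq_or_lt with rfl | hV
  · rw [mul_zero]
    exact hε.le
  have hlog : Real.log (V / ε) ≤ n / κ := by
    rcases le_or_gt (Real.log (V / ε)) 0 with hneg | hpos
    · exact hneg.trans (div_nonneg hn hκ.le)
    · rw [le_div_iff₀' hκ]
      exact (mul_le_mul_of_nonneg_right hK hpos.le).trans h
  calc Real.exp (-(n / κ)) * V ≤ Real.exp (-Real.log (V / ε)) * V := by gcongr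
    _ = ε := by
      rw [Real.exp_neg, Real.exp_log (by positivity)]
      field_simp

/-! ### Chebyshev polynomials -/

section Chebyshev

open Polynomial Chebyshev

theorem two_mul_add_one_mul_le_eval_T_succ_sub {s : ℝ} (hs : 1 ≤ s) (n : ℕ) :
    (2 * n + 1) * (s - 1) ≤ (T ℝ (n + 1)).eval s - (T ℝ n).eval s := by
  induction n with
  | zero => simp
  | succ n ih =>
    have hrec : (T ℝ ((n + 1 : ℕ) + 1)).eval s =
        2 * s * (T ℝ (n + 1)).eval s - (T ℝ n).eval s := by
      rw [show ((n + 1 : ℕ) : ℤ) + 1 = n + 2 by push_cast; ring, T_add_two]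
      simp
    have hone : 1 ≤ (T ℝ (n + 1)).eval s := one_le_eval_T_real _ hs
    rw [hrec]
    push_cast
    nlinarith

theorem one_add_sq_mul_le_eval_T {s : ℝ} (hs : 1 ≤ s) (n : ℕ) :
    1 + (n : ℝ) ^ 2 * (s - 1) ≤ (T ℝ n).eval s := by
  induction n with
  | zero => simp
  | succ n ih =>
    have hdiff := two_mul_add_one_mul_le_eval_T_succ_sub hs n
    push_cast
    linarith

variable {l u : ℝ}

theorem one_le_add_div_sub (hl : 0 ≤ l) (hu : l < u) : 1 ≤ (u + l) / (u - l) := by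
  rw [one_le_div (by linarith)]
  linarith

theorem five_thirds_le_eval_T (hl : 0 < l) (hu : l < u) :
    5 / 3 ≤ (T ℝ ⌊√(u / l)⌋₊).eval ((u + l) / (u - l)) := by
  have hsub : 0 < u - l := sub_pos.mpr hu
  refine le_trans ?_ (one_add_sq_mul_le_eval_T (one_le_add_div_sub hl.le hu) _)
  have hfloor : 1 ≤ ⌊√(u / l)⌋₊ :=
    (Nat.one_le_floor_iff _).mpr (Real.one_le_sqrt.mpr ((one_le_div hl).mpr hu.le))
  have hK : (1 : ℝ) ≤ ⌊√(u / l)⌋₊ := Nat.one_le_cast.mpr hfloor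
  set K : ℝ := (⌊√(u / l)⌋₊ : ℝ)
  have hχK : u / l < (K + 1) ^ 2 :=
    (Real.sqrt_lt' (by linarith)).mp (Nat.lt_floor_add_one _)
  have hul : u < (3 * K ^ 2 + 1) * l := by
    rw [div_lt_iff₀ hl] at hχK
    refine hχK.trans_le (mul_le_mul_of_nonneg_right ?_ hl.le)
    nlinarith
  have hs : K ^ 2 * ((u + l) / (u - l) - 1) = 2 * l * K ^ 2 / (u - l) := by
    field_simp
    ring
  have : 2 / 3 ≤ 2 * l * K ^ 2 / (u - l) := by
    rw [le_div_iff₀ hsub]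
    linarith
  linarith

theorem eval_chebPoly_zero (hl : 0 ≤ l) (hu : l ≤ u) (K : ℕ) : (chebPoly l u K).eval 0 = 0 := by
  rw [chebPoly]
  split_ifs with h
  · simp
  · have hT := one_le_eval_T_real (K : ℤ) (one_le_add_div_sub hl (lt_of_le_of_ne hu h))
    simp [eval_comp, inv_mul_cancel₀ (zero_lt_one.trans_le hT).ne']

theorem eval_chebPoly_mem_Icc (hl : 0 < l) {t : ℝ} (ht : t ∈ Set.Icc l u) :
    (chebPoly l u ⌊√(u / l)⌋₊).eval t ∈ Set.Icc (2 / 5 : ℝ) (8 / 5) := by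
  obtain ⟨hlt, htu⟩ := ht
  rw [chebPoly]
  split_ifs with h
  · obtain rfl : t = u := by linarith
    simp only [eval_mul, eval_C, eval_X, inv_mul_cancel₀ (hl.trans_le hlt).ne']
    norm_num
  · have hu : l < u := lt_of_le_of_ne (hlt.trans htu) h
    have hsub : 0 < u - l := sub_pos.mpr hu
    have hT := five_thirds_le_eval_T hl hu
    set S := (T ℝ ⌊√(u / l)⌋₊).eval ((u + l) / (u - l))
    have harg : |(u + l) / (u - l) - 2 / (u - l) * t| ≤ 1 := by
      rw [show (u + l) / (u - l) - 2 / (u - l) * t = (u + l - 2 * t) / (u - l) by ring, abs_le,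
        le_div_iff₀ hsub, div_le_iff₀ hsub]
      constructor <;> linarith
    have habs := abs_eval_T_real_le_one (⌊√(u / l)⌋₊ : ℤ) harg
    simp only [eval_sub, eval_one, eval_mul, eval_C, eval_comp, eval_X]
    set r := (T ℝ ⌊√(u / l)⌋₊).eval ((u + l) / (u - l) - 2 / (u - l) * t)
    have hr : |S⁻¹ * r| ≤ 3 / 5 := by
      have hS : |S⁻¹| ≤ 3 / 5 := by
        rw [abs_inv, abs_of_pos (by linarith), inv_le_comm₀ (by linarith) (by norm_num)]
        linarith
      calc |S⁻¹ * r| = |S⁻¹| * |r| := abs_mul _ _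
        _ ≤ 3 / 5 * 1 := mul_le_mul hS habs (abs_nonneg _) (by norm_num)
        _ = 3 / 5 := mul_one _
    constructor <;> linarith [abs_le.mp hr]

theorem natDegree_chebPoly_le (l u : ℝ) (K : ℕ) : (chebPoly l u K).natDegree ≤ max 1 K := by
  rw [chebPoly]
  split_ifs
  · exact (natDegree_C_mul_le _ _).trans (natDegree_X_le.trans (le_max_left _ _))
  · have hlinear : (C ((u + l) / (u - l)) - C (2 / (u - l)) * X).natDegree ≤ 1 :=
      (natDegree_sub_le _ _).trans
        (max_le (by simp) ((natDegree_C_mul_le _ _).trans natDegree_X_le))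
    refine (natDegree_sub_le _ _).trans (max_le (by simp) ?_)
    refine (natDegree_C_mul_le _ _).trans (natDegree_comp_le.trans ?_)
    rw [natDegree_T, Int.natAbs_natCast]
    exact (Nat.mul_le_mul_left K hlinear).trans (by simp)

end Chebyshev

section ChebMatrix

variable {ι : Type} [Fintype ι] [DecidableEq ι] {M : Matrix ι ι ℝ}

theorem natDegree_cheb_le (hM : M.PosSemidef) (h0 : M ≠ 0) :
    ((cheb M).natDegree : ℝ) ≤ √(condNum M) := by
  have hχ : 1 ≤ √(condNum M) := Real.one_le_sqrt.mpr (one_le_condNum hM h0)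
  calc ((cheb M).natDegree : ℝ) ≤ (⌊√(condNum M)⌋₊ : ℝ) := by
        exact_mod_cast (natDegree_chebPoly_le _ _ _).trans
          (max_le ((Nat.one_le_floor_iff _).mpr hχ) le_rfl)
    _ ≤ √(condNum M) := Nat.floor_le (Real.sqrt_nonneg _)

theorem eval_cheb_zero (hM : M.PosSemidef) (h0 : M ≠ 0) : (cheb M).eval 0 = 0 :=
  eval_chebPoly_zero (lamMinPos_pos hM h0).le (lamMinPos_le_lamMax hM.1 h0) _

theorem eval_cheb_mem_Icc (hM : M.PosSemidef) (h0 : M ≠ 0) {t : ℝ} (ht : t ∈ spectrum ℝ M)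
    (ht0 : t ≠ 0) : (cheb M).eval t ∈ Set.Icc (2 / 5 : ℝ) (8 / 5) :=
  eval_chebPoly_mem_Icc (lamMinPos_pos hM h0)
    ⟨lamMinPos_le_of_mem_spectrum ht ht0, le_lamMax_of_mem_spectrum ht⟩

theorem eval_cheb_eq_zero_iff (hM : M.PosSemidef) (h0 : M ≠ 0) {t : ℝ} (ht : t ∈ spectrum ℝ M) :
    (cheb M).eval t = 0 ↔ t = 0 := by
  constructor
  · intro heval
    by_contra ht0
    have := (eval_cheb_mem_Icc hM h0 ht ht0).1
    linarith
  · rintro rfl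
    exact eval_cheb_zero hM h0

theorem aeval_cheb_mulVec_eq_zero_iff (hM : M.PosSemidef) (h0 : M ≠ 0) {x : ι → ℝ} :
    Polynomial.aeval M (cheb M) *ᵥ x = 0 ↔ M *ᵥ x = 0 :=
  aeval_mulVec_eq_zero_iff hM.1 fun _ => eval_cheb_eq_zero_iff hM h0

theorem posSemidef_aeval_cheb (hM : M.PosSemidef) (h0 : M ≠ 0) :
    (Polynomial.aeval M (cheb M)).PosSemidef := by
  refine posSemidef_aeval hM.1 fun t ht => ?_
  rcases eq_or_ne t 0 with rfl | ht0
  · exact (eval_cheb_zero hM h0).ge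
  · linarith [(eval_cheb_mem_Icc hM h0 ht ht0).1]

theorem aeval_cheb_ne_zero (hM : M.PosSemidef) (h0 : M ≠ 0) :
    Polynomial.aeval M (cheb M) ≠ 0 := by
  intro hzero
  refine h0 (Matrix.ext_of_mulVec_single fun i => ?_)
  rw [Matrix.zero_mulVec, ← aeval_cheb_mulVec_eq_zero_iff hM h0, hzero, Matrix.zero_mulVec]

theorem condNum_aeval_cheb_le (hM : M.PosSemidef) (h0 : M ≠ 0) :
    condNum (Polynomial.aeval M (cheb M)) ≤ 4 := by
  have hspec : spectrum ℝ (Polynomial.aeval M (cheb M)) \ {0} ⊆ Set.Icc (2 / 5 : ℝ) (8 / 5) := by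
    rw [spectrum_aeval hM.1]
    rintro _ ⟨⟨t, ht, rfl⟩, heval⟩
    refine eval_cheb_mem_Icc hM h0 ht ?_
    rintro rfl
    exact heval (eval_cheb_zero hM h0)
  refine (condNum_le_div_of_spectrum_subset (posSemidef_aeval_cheb hM h0)
    (aeval_cheb_ne_zero hM h0) (by norm_num) hspec).trans_eq ?_
  norm_num

end ChebMatrix

/-! ### Values and costs of programs -/

namespace Prog

variable {m d p : ℕ} (P : Problem m d p) {α β : Type}

/-- The numbers of gradient calls, of communication rounds and of multiplications by `B` and `Bᵀ`,
bundled so that they can be added up together along a run. -/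
noncomputable def cost (x : Prog m d p α) : ℕ × ℕ × ℕ :=
  (x.gradCalls P, x.commRounds P, x.multsB P)

@[simp] theorem out_pure (a : α) : (pure a : Prog m d p α).out P = a := rfl

@[simp] theorem cost_pure (a : α) : (pure a : Prog m d p α).cost P = 0 := rfl

@[simp] theorem out_bind (x : Prog m d p α) (f : α → Prog m d p β) :
    (x >>= f).out P = (f (x.out P)).out P := by
  change (x.andThen f).out P = _
  induction x with
  | ret a => rfl
  | grad x _ ih | comm x _ ih | mulB x _ ih | mulBT x _ ih => exact ih _

@[simp] theorem cost_bind (x : Prog m d p α) (f : α → Prog m d p β) :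
    (x >>= f).cost P = x.cost P + (f (x.out P)).cost P := by
  change (x.andThen f).cost P = _
  induction x with
  | ret a => simp [andThen, cost, out, gradCalls, commRounds, multsB]
  | grad x _ ih | comm x _ ih | mulB x _ ih | mulBT x _ ih =>
    simp only [cost, Prod.mk_add_mk, Prod.mk.injEq] at ih
    simp only [andThen, cost, out, gradCalls, commRounds, multsB, ih, Prod.mk_add_mk,
      add_right_comm]

@[simp] theorem out_callGrad (x : Stack m d) :
    (callGrad x : Prog m d p _).out P = P.gradF x := rfl

@[simp] theorem out_callW (x : Stack m d) :
    (callW x : Prog m d p _).out P = (bigW d P.W).toEuclideanLin x := rfl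

@[simp] theorem out_callB (x : Stack m d) :
    (callB x : Prog m d p _).out P = (bigB m P.B).toEuclideanLin x := rfl

@[simp] theorem out_callBT (u : Stack m p) :
    (callBT u : Prog m d p _).out P = (bigB m P.Bᵀ).toEuclideanLin u := rfl

@[simp] theorem cost_callGrad (x : Stack m d) :
    (callGrad x : Prog m d p _).cost P = (1, 0, 0) := rfl

@[simp] theorem cost_callW (x : Stack m d) :
    (callW x : Prog m d p _).cost P = (0, 1, 0) := rfl

@[simp] theorem cost_callB (x : Stack m d) :
    (callB x : Prog m d p _).cost P = (0, 0, 1) := rfl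

@[simp] theorem cost_callBT (u : Stack m p) :
    (callBT u : Prog m d p _).cost P = (0, 0, 1) := rfl

section Direct

variable (γ : ℝ) (c : APDGParams)

theorem out_callA (x : Stack m d) :
    (callA γ x : Prog m d p _).out P = (conMat P.B P.W γ).toEuclideanLin x := by
  simp only [callA, out_bind, out_pure, out_callB, out_callW, conMat, Matrix.toLpLin_apply,
    Matrix.fromRows_mulVec, Matrix.smul_mulVec]

theorem out_callAT (hW : P.W.IsHermitian) (y : Mult m p d) :
    (callAT γ y : Prog m d p _).out P = (conMat P.B P.W γ)ᵀ.toEuclideanLin y := by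
  simp only [callAT, out_bind, out_pure, out_callBT, out_callW, conMat,
    Matrix.transpose_fromRows, Matrix.transpose_smul, bigB_transpose, bigW_transpose hW,
    Matrix.toLpLin_apply, Matrix.fromCols_mulVec, Matrix.smul_mulVec]
  rfl

theorem out_apdgStep (hW : P.W.IsHermitian) (s : APDGState (Stack m d) (Mult m p d)) :
    (Prog.apdgStep γ c s).out P = DecOpt.apdgStep (conMat P.B P.W γ) P.gradF c s := by
  simp only [Prog.apdgStep, out_bind, out_pure, out_callA, out_callAT P γ hW, out_callGrad]
  rfl

theorem out_apdg (hW : P.W.IsHermitian) (x₀ : Stack m d) (y₀ : Mult m p d) (N : ℕ) :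
    (Prog.apdg γ c x₀ y₀ N).out P = DecOpt.apdg (conMat P.B P.W γ) P.gradF c x₀ y₀ N := by
  induction N with
  | zero => rfl
  | succ N ih => rw [Prog.apdg, out_bind, ih, out_apdgStep P γ c hW, DecOpt.apdg]

theorem cost_apdgStep (s : APDGState (Stack m d) (Mult m p d)) :
    (Prog.apdgStep γ c s).cost P = (1, 6, 6) := by
  simp [Prog.apdgStep, callA, callAT]

theorem cost_apdg (x₀ : Stack m d) (y₀ : Mult m p d) (N : ℕ) :
    (Prog.apdg γ c x₀ y₀ N).cost P = N • (1, 6, 6) := by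
  induction N with
  | zero => rfl
  | succ N ih => rw [Prog.apdg, cost_bind, ih, cost_apdgStep, succ_nsmul]

end Direct

section Horner

variable {op : Stack m d → Prog m d p (Stack m d)} (q : Polynomial ℝ) (x : Stack m d)

theorem out_hornerAux {T : Matrix (Fin m × Fin d) (Fin m × Fin d) ℝ}
    (hT : ∀ z, (op z).out P = T.toEuclideanLin z) {j : ℕ} (hj : j ≤ q.natDegree) :
    (hornerAux op q x j).out P =
      (∑ i ∈ Finset.range (j + 1), q.coeff (q.natDegree - j + i) • T ^ i).toEuclideanLin x := by
  induction j with
  | zero => simp [hornerAux]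
  | succ j ih =>
    rw [hornerAux, out_bind, out_bind, out_pure, hT, ih (by omega), ← toEuclideanLin_mul_apply,
      Finset.sum_range_succ' _ (j + 1), Finset.mul_sum, map_add, LinearMap.add_apply]
    congr 2
    · congr 1
      refine Finset.sum_congr rfl fun i _ => ?_
      rw [Matrix.mul_smul, pow_succ', show q.natDegree - (j + 1) + (i + 1) = q.natDegree - j + i
        by omega]
    · simp

theorem out_horner {T : Matrix (Fin m × Fin d) (Fin m × Fin d) ℝ}
    (hT : ∀ z, (op z).out P = T.toEuclideanLin z) :
    (horner op q x).out P = (Polynomial.aeval T q).toEuclideanLin x := by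
  rw [horner, out_hornerAux P q x hT le_rfl, Polynomial.aeval_eq_sum_range]
  simp

theorem cost_hornerAux {n : ℕ × ℕ × ℕ} (hn : ∀ z, (op z).cost P = n) (j : ℕ) :
    (hornerAux op q x j).cost P = j • n := by
  induction j with
  | zero => simp [hornerAux]
  | succ j ih => rw [hornerAux, cost_bind, cost_bind, cost_pure, hn, ih, add_zero, succ_nsmul]

theorem cost_horner {n : ℕ × ℕ × ℕ} (hn : ∀ z, (op z).cost P = n) :
    (horner op q x).cost P = q.natDegree • n :=
  cost_hornerAux P q x hn _

end Horner

end Prog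

theorem aeval_bigW {m : ℕ} (d : ℕ) (W : Matrix (Fin m) (Fin m) ℝ) (q : Polynomial ℝ) :
    Polynomial.aeval (bigW d W) q = bigW d (Polynomial.aeval W q) := by
  let φ : Matrix (Fin m) (Fin m) ℝ →ₐ[ℝ] Matrix (Fin m × Fin d) (Fin m × Fin d) ℝ :=
    AlgHom.ofLinearMap
      { toFun := bigW d
        map_add' := fun X Y => Matrix.add_kronecker X Y 1
        map_smul' := fun r X => Matrix.smul_kronecker r X 1 }
      Matrix.one_kronecker_one fun X Y => (bigW_mul X Y).symm
  exact Polynomial.aeval_algHom_apply φ W q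

theorem aeval_bigB {d : ℕ} (m : ℕ) (Q : Matrix (Fin d) (Fin d) ℝ) (q : Polynomial ℝ) :
    Polynomial.aeval (bigB m Q) q = bigB m (Polynomial.aeval Q q) := by
  let φ : Matrix (Fin d) (Fin d) ℝ →ₐ[ℝ] Matrix (Fin m × Fin d) (Fin m × Fin d) ℝ :=
    AlgHom.ofLinearMap
      { toFun := bigB m
        map_add' := fun X Y => Matrix.kronecker_add 1 X Y
        map_smul' := fun r X => Matrix.kronecker_smul r 1 X }
      Matrix.one_kronecker_one fun X Y => (bigB_mul X Y).symm
  exact Polynomial.aeval_algHom_apply φ Q q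

/-- Replaces the multipliers `y` of a state by `p = Aᵀ y`: the map from the states of APDG to those
of its form that uses `A` only through `Aᵀ A`. -/
noncomputable def APDGState.pullback {ι κ : Type} [Fintype κ] [DecidableEq κ]
    (A : Matrix κ ι ℝ) (s : APDGState (EuclideanSpace ℝ ι) (EuclideanSpace ℝ κ)) :
    APDGState (EuclideanSpace ℝ ι) (EuclideanSpace ℝ ι) :=
  ⟨s.x, s.xf, Aᵀ.toEuclideanLin s.y, Aᵀ.toEuclideanLin s.yPrev, Aᵀ.toEuclideanLin s.yf⟩

namespace Prog

variable {m d p : ℕ} (P : Problem m d p) (qW qB : Polynomial ℝ) (γ : ℝ) (c : APDGParams)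

theorem out_callBTB (x : Stack m d) :
    (callBTB x : Prog m d p _).out P = (bigB m (P.Bᵀ * P.B)).toEuclideanLin x := by
  rw [callBTB, out_bind, out_callB, out_callBT, ← toEuclideanLin_mul_apply, bigB_mul]

theorem cost_callBTB (x : Stack m d) : (callBTB x : Prog m d p _).cost P = (0, 0, 2) := by
  simp [callBTB]

theorem out_callGram (x : Stack m d) :
    (callGram qW qB γ x : Prog m d p _).out P =
      (bigB m (Polynomial.aeval (P.Bᵀ * P.B) qB) + γ ^ 2 • bigW d (Polynomial.aeval P.W qW *
        Polynomial.aeval P.W qW)).toEuclideanLin x := by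
  simp only [callGram, out_bind, out_pure, out_horner P qB x (out_callBTB P),
    out_horner P qW _ (out_callW P), aeval_bigB, aeval_bigW, ← bigW_mul, map_add, map_smul,
    LinearMap.add_apply, LinearMap.smul_apply, toEuclideanLin_mul_apply]

theorem cost_callGram (x : Stack m d) :
    (callGram qW qB γ x : Prog m d p _).cost P = (0, 2 * qW.natDegree, 2 * qB.natDegree) := by
  simp [callGram, cost_horner P _ _ (cost_callBTB P), cost_horner P _ _ (cost_callW P), two_mul,
    mul_two]

theorem cost_accStep (s : APDGState (Stack m d) (Stack m d)) :
    (accStep qW qB γ c s : Prog m d p _).cost P =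
      (1, 6 * qW.natDegree, 6 * qB.natDegree) := by
  simp only [accStep, cost_bind, cost_callGrad, cost_callGram, cost_pure, Prod.mk_add_mk, add_zero,
    zero_add]
  ring_nf

theorem cost_acc (x₀ p₀ : Stack m d) (N : ℕ) :
    (acc qW qB γ c x₀ p₀ N : Prog m d p _).cost P =
      N • (1, 6 * qW.natDegree, 6 * qB.natDegree) := by
  induction N with
  | zero => simp [acc]
  | succ N ih => rw [acc, cost_bind, ih, cost_accStep, succ_nsmul]

section Pullback

variable {κ : Type} [Fintype κ] [DecidableEq κ] {A : Matrix κ (Fin m × Fin d) ℝ}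

theorem out_accStep_pullback
    (hA : Aᵀ * A = bigB m (Polynomial.aeval (P.Bᵀ * P.B) qB) + γ ^ 2 • bigW d
      (Polynomial.aeval P.W qW * Polynomial.aeval P.W qW))
    (s : APDGState (Stack m d) (EuclideanSpace ℝ κ)) :
    (accStep qW qB γ c (s.pullback A)).out P = (DecOpt.apdgStep A P.gradF c s).pullback A := by
  simp only [accStep, out_bind, out_pure, out_callGram, out_callGrad, ← hA,
    toEuclideanLin_mul_apply, APDGState.pullback, DecOpt.apdgStep, map_add, map_sub, map_smul]

theorem out_acc
    (hA : Aᵀ * A = bigB m (Polynomial.aeval (P.Bᵀ * P.B) qB) + γ ^ 2 • bigW d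
      (Polynomial.aeval P.W qW * Polynomial.aeval P.W qW))
    (x₀ : Stack m d) (y₀ : EuclideanSpace ℝ κ) (N : ℕ) :
    (acc qW qB γ c x₀ (Aᵀ.toEuclideanLin y₀) N : Prog m d p _).out P =
      (DecOpt.apdg A P.gradF c x₀ y₀ N).pullback A := by
  induction N with
  | zero => rfl
  | succ N ih => rw [acc, out_bind, ih, out_accStep_pullback P qW qB γ c hA, DecOpt.apdg]

end Pullback

end Prog

/-! ### Ranges and kernels of the constraint matrices -/

section Range

variable {ι κ : Type*} [Fintype ι] [DecidableEq ι] [Fintype κ] [DecidableEq κ]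

theorem transpose_toEuclideanLin_eq_adjoint (A : Matrix κ ι ℝ) :
    Aᵀ.toEuclideanLin = A.toEuclideanLin.adjoint := by
  rw [← Matrix.conjTranspose_eq_transpose_of_trivial,
    Matrix.toEuclideanLin_conjTranspose_eq_adjoint]

theorem range_transpose_eq_orthogonal_ker (A : Matrix κ ι ℝ) :
    Aᵀ.toEuclideanLin.range = A.toEuclideanLin.kerᗮ := by
  rw [transpose_toEuclideanLin_eq_adjoint, LinearMap.orthogonal_ker]

theorem range_transpose_mul_self (A : Matrix κ ι ℝ) :
    (Aᵀ * A).toEuclideanLin.range = Aᵀ.toEuclideanLin.range := by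
  have hcomp : (Aᵀ * A).toEuclideanLin = A.toEuclideanLin.adjoint ∘ₗ A.toEuclideanLin := by
    ext1 x
    rw [toEuclideanLin_mul_apply, transpose_toEuclideanLin_eq_adjoint, LinearMap.comp_apply]
  calc (Aᵀ * A).toEuclideanLin.range = (Aᵀ * A)ᵀ.toEuclideanLin.range := by
        rw [Matrix.transpose_mul, Matrix.transpose_transpose]
    _ = Aᵀ.toEuclideanLin.range := by
        rw [range_transpose_eq_orthogonal_ker, range_transpose_eq_orthogonal_ker, hcomp,
          LinearMap.ker_adjoint_comp_self]

theorem exists_mem_range_transpose_eq (A : Matrix κ ι ℝ) {z : EuclideanSpace ℝ ι}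
    (hz : z ∈ Aᵀ.toEuclideanLin.range) :
    ∃ y ∈ A.toEuclideanLin.range, Aᵀ.toEuclideanLin y = z := by
  rw [← range_transpose_mul_self] at hz
  obtain ⟨x, rfl⟩ := hz
  exact ⟨A.toEuclideanLin x, ⟨x, rfl⟩, (toEuclideanLin_mul_apply _ _ _).symm⟩

end Range

theorem transpose_mul_self_mulVec_eq_zero_iff {ι κ : Type*} [Fintype ι] [Fintype κ]
    (A : Matrix κ ι ℝ) (x : ι → ℝ) : (Aᵀ * A) *ᵥ x = 0 ↔ A *ᵥ x = 0 := by
  rw [← Matrix.conjTranspose_eq_transpose_of_trivial,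
    Matrix.conjTranspose_mul_self_mulVec_eq_zero]

section Kernel

variable {m d q : ℕ} (B : Matrix (Fin q) (Fin d) ℝ) (W : Matrix (Fin m) (Fin m) ℝ)

theorem bigB_toEuclideanLin_apply (x : Stack m d) (i : Fin m) (k : Fin q) :
    (bigB m B).toEuclideanLin x (i, k) = (B *ᵥ fun j => x (i, j)) k := by
  simp [Matrix.toLpLin_apply, bigB, Matrix.mulVec, dotProduct, Fintype.sum_prod_type,
    Matrix.kroneckerMap_apply, Matrix.one_apply, ite_mul]

theorem bigW_toEuclideanLin_apply (x : Stack m d) (i : Fin m) (k : Fin d) :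
    (bigW d W).toEuclideanLin x (i, k) = (W *ᵥ fun l => x (l, k)) i := by
  simp [Matrix.toLpLin_apply, bigW, Matrix.mulVec, dotProduct, Fintype.sum_prod_type,
    Matrix.kroneckerMap_apply, Matrix.one_apply, ite_mul]

theorem bigB_toEuclideanLin_eq_zero_iff (x : Stack m d) :
    (bigB m B).toEuclideanLin x = 0 ↔ ∀ i, (B *ᵥ fun j => x (i, j)) = 0 := by
  simp only [PiLp.ext_iff, Prod.forall, bigB_toEuclideanLin_apply, PiLp.zero_apply, funext_iff,
    Pi.zero_apply]

theorem bigW_toEuclideanLin_eq_zero_iff (x : Stack m d) :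
    (bigW d W).toEuclideanLin x = 0 ↔ ∀ k, (W *ᵥ fun i => x (i, k)) = 0 := by
  simp only [PiLp.ext_iff, Prod.forall, bigW_toEuclideanLin_apply, PiLp.zero_apply, funext_iff,
    Pi.zero_apply]
  exact forall_comm

theorem conMat_toEuclideanLin_eq_zero_iff {γ : ℝ} (hγ : γ ≠ 0) (x : Stack m d) :
    (conMat B W γ).toEuclideanLin x = 0 ↔
      (bigW d W).toEuclideanLin x = 0 ∧ (bigB m B).toEuclideanLin x = 0 := by
  have hrows : (conMat B W γ).toEuclideanLin x = 0 ↔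
      (bigB m B).toEuclideanLin x = 0 ∧ γ • (bigW d W).toEuclideanLin x = 0 := by
    simp only [Matrix.toLpLin_apply, conMat, Matrix.fromRows_mulVec, Matrix.smul_mulVec,
      PiLp.ext_iff, Sum.forall, Sum.elim_inl, Sum.elim_inr, PiLp.zero_apply, PiLp.smul_apply,
      Pi.smul_apply]
  rw [hrows, smul_eq_zero_iff_right hγ, and_comm]

end Kernel

/-! ### Consequences of the quadratic bounds -/

namespace QuadraticBounds

variable {E : Type*} [NormedAddCommGroup E] [InnerProductSpace ℝ E] {μ L : ℝ} {f : E → ℝ}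
  {g : E → E}

theorem mu_le_L [Nontrivial E] (h : QuadraticBounds μ L f g) : μ ≤ L := by
  obtain ⟨v, hv⟩ := exists_ne (0 : E)
  have hv_sq : 0 < ‖v - 0‖ ^ 2 := by rw [sub_zero]; positivity
  have hbounds : μ / 2 * ‖v - 0‖ ^ 2 ≤ L / 2 * ‖v - 0‖ ^ 2 := by
    linarith [h.lower 0 v, h.upper 0 v]
  linarith [le_of_mul_le_mul_right hbounds hv_sq]

theorem inner_eq_zero_of_forall_le_add_smul (h : QuadraticBounds μ L f g) {x v : E}
    (hmin : ∀ t : ℝ, f x ≤ f (x + t • v)) : inner ℝ (g x) v = 0 := by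
  have hquad : ∀ t : ℝ, 0 ≤ L / 2 * ‖v‖ ^ 2 * (t * t) + inner ℝ (g x) v * t + 0 := fun t => by
    have hupper := h.upper x (x + t • v)
    rw [add_sub_cancel_left, real_inner_smul_right, norm_smul, mul_pow, Real.norm_eq_abs,
      sq_abs] at hupper
    linarith [hmin t]
  have hdiscrim := discrim_le_zero hquad
  rw [discrim, mul_zero, sub_zero] at hdiscrim
  exact pow_eq_zero_iff two_ne_zero |>.mp (hdiscrim.antisymm (sq_nonneg _))

theorem abs_sub_le (h : QuadraticBounds μ L f g) (hμ : 0 ≤ μ) (x y : E) :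
    |f y - f x| ≤ ‖g x‖ * ‖y - x‖ + L / 2 * ‖y - x‖ ^ 2 := by
  have hnonneg := h.bregman_nonneg hμ x y
  have hle := h.bregman_le x y
  calc |f y - f x| = |inner ℝ (g x) (y - x) + bregman f g x y| := by
        rw [bregman, add_sub_cancel]
    _ ≤ |inner ℝ (g x) (y - x)| + |bregman f g x y| := abs_add_le _ _
    _ ≤ ‖g x‖ * ‖y - x‖ + L / 2 * ‖y - x‖ ^ 2 :=
        add_le_add (abs_real_inner_le_norm _ _) ((abs_of_nonneg hnonneg).trans_le hle)

theorem abs_sub_le_of_norm_sub_le (h : QuadraticBounds μ L f g) (hμ : 0 ≤ μ) (hL : 0 ≤ L)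
    {x y : E} {e D : ℝ} (he : 0 ≤ e) (he1 : e ≤ 1) (hD : 0 ≤ D) (hg : ‖g x‖ ≤ L / 2 * D)
    (hxy : ‖y - x‖ ≤ e * D) : |f y - f x| ≤ e * (L * D ^ 2) := by
  calc |f y - f x| ≤ ‖g x‖ * ‖y - x‖ + L / 2 * ‖y - x‖ ^ 2 := h.abs_sub_le hμ x y
    _ ≤ L / 2 * D * (e * D) + L / 2 * (e * D) ^ 2 := by gcongr
    _ = L / 2 * D ^ 2 * (e + e * e) := by ring
    _ ≤ L / 2 * D ^ 2 * (e + e * 1) := by gcongr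
    _ = e * (L * D ^ 2) := by ring

end QuadraticBounds

theorem SingularBounds.norm_le {ι κ : Type} [Fintype ι] [DecidableEq ι] [Fintype κ]
    [DecidableEq κ] {A : Matrix κ ι ℝ} {l Λ : ℝ} (hA : SingularBounds A l Λ)
    (x : EuclideanSpace ℝ ι) : ‖A.toEuclideanLin x‖ ≤ √Λ * ‖x‖ := by
  calc ‖A.toEuclideanLin x‖ = √(‖A.toEuclideanLin x‖ ^ 2) := (Real.sqrt_sq (norm_nonneg _)).symm
    _ ≤ √(Λ * ‖x‖ ^ 2) := Real.sqrt_le_sqrt (hA.norm_sq_le x)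
    _ = √Λ * ‖x‖ := by rw [Real.sqrt_mul' _ (sq_nonneg _), Real.sqrt_sq (norm_nonneg _)]

/-! ### The decentralized problem -/

section Block

variable {m q : ℕ}

theorem inner_eq_sum_block (x y : Stack m q) :
    inner ℝ x y = ∑ i, inner ℝ (block x i) (block y i) := by
  simp only [PiLp.inner_apply, block, Fintype.sum_prod_type]

theorem norm_sq_eq_sum_block (x : Stack m q) : ‖x‖ ^ 2 = ∑ i, ‖block x i‖ ^ 2 := by
  simp only [← real_inner_self_eq_norm_sq, inner_eq_sum_block]

theorem block_sub (x y : Stack m q) (i : Fin m) : block (x - y) i = block x i - block y i := rfl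

end Block

namespace Problem

variable {m d p : ℕ} {P : Problem m d p}

theorem block_gradF (P : Problem m d p) (x : Stack m d) (i : Fin m) :
    block (P.gradF x) i = gradient (P.f i) (block x i) := rfl

theorem quadraticBounds_F (hf : ∀ i, StronglyConvexSmooth P.μ P.L (P.f i)) :
    QuadraticBounds P.μ P.L P.F P.gradF := by
  constructor
  all_goals
    intro x y
    simp only [F, inner_eq_sum_block, norm_sq_eq_sum_block, block_gradF, block_sub,
      Finset.mul_sum, ← Finset.sum_add_distrib]
  · exact Finset.sum_le_sum fun i _ => (hf i).lower _ _
  · exact Finset.sum_le_sum fun i _ => (hf i).upper _ _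

/-- Problems with strongly convex and smooth objective whose constraint matrices `B` and
`W ≥ 0` are nonzero and singular. In contrast to `Problem.Valid`, this class is closed under
Chebyshev preconditioning, which replaces `W` by a polynomial of `W` that need not be compatible
with the graph. -/
structure Regular (P : Problem m d p) : Prop where
  posSemidef_W : P.W.PosSemidef
  W_ne_zero : P.W ≠ 0
  ker_W : ∃ v : Fin m → ℝ, v ≠ 0 ∧ P.W *ᵥ v = 0
  B_ne_zero : P.B ≠ 0
  ker_B : ∃ x : Fin d → ℝ, x ≠ 0 ∧ P.B *ᵥ x = 0
  mu_pos : 0 < P.μ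
  objective : ∀ i, StronglyConvexSmooth P.μ P.L (P.f i)

theorem Valid.regular (hP : P.Valid) : P.Regular where
  posSemidef_W := hP.mixing.posSemidef
  W_ne_zero hW := by
    have := Fin.nontrivial_iff_two_le.mpr hP.two_le
    obtain ⟨i, j, hij⟩ := exists_pair_ne (Fin m)
    have hconst := (hP.mixing.kernel (Pi.single i 1)).mp (by rw [hW, Matrix.zero_mulVec]) i j
    rw [Pi.single_eq_same, Pi.single_eq_of_ne hij.symm] at hconst
    exact one_ne_zero hconst
  ker_W := by
    have := Fin.pos_iff_nonempty.mp (two_pos.trans_le hP.two_le)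
    exact ⟨1, one_ne_zero, (hP.mixing.kernel 1).mpr fun _ _ => rfl⟩
  B_ne_zero := hP.B_ne_zero
  ker_B := hP.ker_B
  mu_pos := hP.mu_pos
  objective := hP.objective

theorem BTB_mulVec_eq_zero_iff (P : Problem m d p) (x : Fin d → ℝ) :
    (P.Bᵀ * P.B) *ᵥ x = 0 ↔ P.B *ᵥ x = 0 :=
  transpose_mul_self_mulVec_eq_zero_iff P.B x

namespace Regular

theorem mu_le_L (hP : P.Regular) : P.μ ≤ P.L := by
  obtain ⟨i⟩ := nonempty_of_matrix_ne_zero hP.W_ne_zero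
  obtain ⟨v, hv, -⟩ := hP.ker_B
  have : Nontrivial (EuclideanSpace ℝ (Fin d)) :=
    ⟨WithLp.toLp 2 v, 0, (WithLp.toLp_eq_zero 2).not.mpr hv⟩
  have hf : QuadraticBounds P.μ P.L (P.f i) (gradient (P.f i)) :=
    ⟨(hP.objective i).lower, (hP.objective i).upper⟩
  exact hf.mu_le_L

theorem L_pos (hP : P.Regular) : 0 < P.L := hP.mu_pos.trans_le hP.mu_le_L

theorem one_le_L_div_mu (hP : P.Regular) : 1 ≤ P.L / P.μ :=
  (one_le_div hP.mu_pos).mpr hP.mu_le_L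

theorem BTB_ne_zero (hP : P.Regular) : P.Bᵀ * P.B ≠ 0 := by
  rw [← Matrix.conjTranspose_eq_transpose_of_trivial, Ne, Matrix.conjTranspose_mul_self_eq_zero]
  exact hP.B_ne_zero

theorem zero_mem_spectrum_W (hP : P.Regular) : 0 ∈ spectrum ℝ P.W := by
  obtain ⟨v, hv, hWv⟩ := hP.ker_W
  exact zero_mem_spectrum_of_mulVec_eq_zero hv hWv

theorem zero_mem_spectrum_BTB (hP : P.Regular) : 0 ∈ spectrum ℝ (P.Bᵀ * P.B) := by
  obtain ⟨x, hx, hBx⟩ := hP.ker_B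
  exact zero_mem_spectrum_of_mulVec_eq_zero hx ((P.BTB_mulVec_eq_zero_iff x).mpr hBx)

theorem gammaOpt_pos (hP : P.Regular) : 0 < gammaOpt (P.Bᵀ * P.B) P.W :=
  DecOpt.gammaOpt_pos (posSemidef_transpose_mul_self P.B) hP.BTB_ne_zero hP.posSemidef_W
    hP.W_ne_zero

theorem A_transpose_mul_A (hP : P.Regular) :
    P.Aᵀ * P.A =
      bigB m (P.Bᵀ * P.B) + gammaOpt (P.Bᵀ * P.B) P.W ^ 2 • bigW d (P.W * P.W) :=
  conMat_transpose_mul_conMat P.B hP.posSemidef_W.1 _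

theorem A_transpose_mul_A_ne_zero (hP : P.Regular) : P.Aᵀ * P.A ≠ 0 := by
  rw [hP.A_transpose_mul_A]
  exact gram_ne_zero (posSemidef_transpose_mul_self P.B) hP.BTB_ne_zero hP.posSemidef_W.1
    hP.W_ne_zero hP.gammaOpt_pos.ne'

theorem condNum_A_transpose_mul_A (hP : P.Regular) :
    condNum (P.Aᵀ * P.A) = condNum P.W ^ 2 + condNum (P.Bᵀ * P.B) := by
  rw [hP.A_transpose_mul_A]
  exact condNum_gram_gammaOpt (posSemidef_transpose_mul_self P.B) hP.posSemidef_W hP.BTB_ne_zero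
    hP.W_ne_zero hP.zero_mem_spectrum_BTB hP.zero_mem_spectrum_W

theorem isMinOn_condNum (hP : P.Regular) :
    IsMinOn (fun γ : ℝ => condNum ((conMat P.B P.W γ)ᵀ * conMat P.B P.W γ)) (Set.Ioi 0)
      (gammaOpt (P.Bᵀ * P.B) P.W) := by
  intro γ hγ
  change condNum (P.Aᵀ * P.A) ≤ condNum ((conMat P.B P.W γ)ᵀ * conMat P.B P.W γ)
  rw [hP.condNum_A_transpose_mul_A, conMat_transpose_mul_conMat P.B hP.posSemidef_W.1]
  exact le_condNum_gram (posSemidef_transpose_mul_self P.B) hP.posSemidef_W hP.BTB_ne_zero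
    hP.W_ne_zero hP.zero_mem_spectrum_BTB hP.zero_mem_spectrum_W (ne_of_gt hγ)

theorem A_toEuclideanLin_eq_zero_iff (hP : P.Regular) (x : Stack m d) :
    P.A.toEuclideanLin x = 0 ↔ P.Feasible x :=
  conMat_toEuclideanLin_eq_zero_iff P.B P.W hP.gammaOpt_pos.ne' x

theorem inner_gradF_eq_zero (hP : P.Regular) {xs w : Stack m d} (hxs : P.IsSolution xs)
    (hw : P.A.toEuclideanLin w = 0) : inner ℝ (P.gradF xs) w = 0 := by
  refine (quadraticBounds_F hP.objective).inner_eq_zero_of_forall_le_add_smul fun t => hxs.2 _ ?_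
  rw [← hP.A_toEuclideanLin_eq_zero_iff, map_add, map_smul, hw, smul_zero, add_zero,
    hP.A_toEuclideanLin_eq_zero_iff]
  exact hxs.1

theorem exists_isSaddlePoint (hP : P.Regular) {xs : Stack m d} (hxs : P.IsSolution xs) :
    ∃ ys, IsSaddlePoint P.A P.gradF xs ys := by
  have hgrad : -P.gradF xs ∈ P.Aᵀ.toEuclideanLin.range := by
    rw [range_transpose_eq_orthogonal_ker, Submodule.neg_mem_iff, Submodule.mem_orthogonal']
    exact fun w hw => hP.inner_gradF_eq_zero hxs hw
  obtain ⟨ys, hys, hys_eq⟩ := exists_mem_range_transpose_eq P.A hgrad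
  exact ⟨ys, (hP.A_toEuclideanLin_eq_zero_iff xs).mpr hxs.1, hys, hys_eq⟩

end Regular

/-! ### Accuracy of APDG on the decentralized problem -/

theorem initError_nonneg (hμ : 0 ≤ P.μ) (xs x₀ p₀ : Stack m d) : 0 ≤ P.initError xs x₀ p₀ := by
  rw [initError]
  positivity

theorem norm_gradF_le_mul_initError (hμ : 0 < P.μ) (xs x₀ p₀ : Stack m d) :
    ‖P.gradF xs‖ ≤ P.μ * P.initError xs x₀ p₀ := by
  have hsum : 0 ≤ P.μ * ‖x₀ - xs‖ + ‖p₀‖ := by positivity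
  calc ‖P.gradF xs‖ ≤ P.μ * ‖x₀ - xs‖ + ‖p₀‖ + ‖P.gradF xs‖ := le_add_of_nonneg_left hsum
    _ = P.μ * P.initError xs x₀ p₀ := by rw [initError]; field_simp; ring

/-- The number `κ = max {√χ √(L/μ), χ}`, where `χ = χ(M)`, such that APDG contracts in `O(κ)`
iterations for a constraint matrix `𝐀` with `𝐀ᵀ𝐀 = M`. -/
noncomputable def rate (P : Problem m d p) (M : Matrix (Fin m × Fin d) (Fin m × Fin d) ℝ) : ℝ :=
  rateNum P.μ P.L (lamMinPos M) (lamMax M)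

theorem rate_eq (P : Problem m d p) (M : Matrix (Fin m × Fin d) (Fin m × Fin d) ℝ) :
    P.rate M = max (√(condNum M) * √(P.L / P.μ)) (condNum M) := rfl

namespace Regular

theorem hasComplexity_of_exp_decay (hP : P.Regular) {xs x₀ p₀ : Stack m d}
    (hxs : P.Feasible xs) {x : ℕ → Stack m d} {C κ κ₀ : ℝ} (hC : 2 ≤ C)
    (hκ₀ : 0 < κ₀) (hκ : κ₀ ≤ C * κ)
    (hdecay : ∀ N : ℕ, ‖x N - xs‖ ≤
      Real.exp (-(N / κ₀)) * (2 * (P.L / P.μ) * P.initError xs x₀ p₀)) :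
    P.HasComplexity C κ (C * (P.L / P.μ) * P.initError xs x₀ p₀) xs x := by
  have hμ := hP.mu_pos
  have hL := hP.L_pos
  have hinit : 0 ≤ P.initError xs x₀ p₀ := initError_nonneg hμ.le xs x₀ p₀
  set D := C * (P.L / P.μ) * P.initError xs x₀ p₀
  have hD_ge : 2 * (P.L / P.μ) * P.initError xs x₀ p₀ ≤ D :=
    mul_le_mul_of_nonneg_right (mul_le_mul_of_nonneg_right hC (by positivity)) hinit
  have hD : 0 ≤ D := le_trans (by positivity) hD_ge
  have hgrad : ‖P.gradF xs‖ ≤ P.L / 2 * D :=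
    calc ‖P.gradF xs‖ ≤ P.μ * P.initError xs x₀ p₀ := norm_gradF_le_mul_initError hμ xs x₀ p₀
      _ ≤ P.L * (P.L / P.μ * P.initError xs x₀ p₀) :=
          mul_le_mul hP.mu_le_L (le_mul_of_one_le_left hinit hP.one_le_L_div_mu) hinit hL.le
      _ = P.L / 2 * (2 * (P.L / P.μ) * P.initError xs x₀ p₀) := by ring
      _ ≤ P.L / 2 * D := by gcongr
  intro ε hε N
  have hN : (0 : ℝ) ≤ N := Nat.cast_nonneg N
  set e := Real.exp (-(N / κ₀)) with he_def
  have he : 0 ≤ e := (Real.exp_pos _).le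
  have he_le : e ≤ 1 := by rw [he_def, Real.exp_le_one_iff, neg_nonpos]; positivity
  have hdist : ‖x N - xs‖ ≤ e * D := (hdecay N).trans (mul_le_mul_of_nonneg_left hD_ge he)
  have hconstraint : ‖P.A.toEuclideanLin (x N)‖ ≤ e * (√(lamMax (P.Aᵀ * P.A)) * D) :=
    calc ‖P.A.toEuclideanLin (x N)‖ = ‖P.A.toEuclideanLin (x N - xs)‖ := by
          rw [map_sub, (hP.A_toEuclideanLin_eq_zero_iff xs).mpr hxs, sub_zero]
      _ ≤ √(lamMax (P.Aᵀ * P.A)) * ‖x N - xs‖ := (singularBounds_lamMinPos_lamMax P.A).norm_le _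
      _ ≤ √(lamMax (P.Aᵀ * P.A)) * (e * D) := by gcongr
      _ = e * (√(lamMax (P.Aᵀ * P.A)) * D) := by ring
  exact ⟨le_of_exp_decay hκ₀ hκ hD hε hN hdist,
    le_of_exp_decay hκ₀ hκ (by positivity) hε hN
      ((quadraticBounds_F hP.objective).abs_sub_le_of_norm_sub_le hμ.le hL.le he he_le hD hgrad
        hdist),
    le_of_exp_decay hκ₀ hκ (by positivity) hε hN hconstraint⟩

theorem one_le_rate_A (hP : P.Regular) : 1 ≤ P.rate (P.Aᵀ * P.A) :=
  have hpsd := posSemidef_transpose_mul_self P.A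
  one_le_rateNum (lamMinPos_pos hpsd hP.A_transpose_mul_A_ne_zero)
    (lamMinPos_le_lamMax hpsd.1 hP.A_transpose_mul_A_ne_zero)

theorem norm_apdg_sub_le (hP : P.Regular) {xs : Stack m d} (hxs : P.IsSolution xs)
    (x₀ : Stack m d) {y₀ : Mult m p d} (hy₀ : y₀ ∈ P.A.toEuclideanLin.range) (N : ℕ) :
    ‖(apdg P.A P.gradF (P.params apdgRule (P.Aᵀ * P.A)) x₀ y₀ N).x - xs‖ ≤
      Real.exp (-(N / (32 * P.rate (P.Aᵀ * P.A)))) *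
        (2 * (P.L / P.μ) * P.initError xs x₀ (P.Aᵀ.toEuclideanLin y₀)) := by
  have hpsd := posSemidef_transpose_mul_self P.A
  have hA0 := hP.A_transpose_mul_A_ne_zero
  obtain ⟨ys, hsaddle⟩ := hP.exists_isSaddlePoint hxs
  exact norm_apdg_apdgRule_sub_le hP.mu_pos hP.mu_le_L (lamMinPos_pos hpsd hA0)
    (lamMinPos_le_lamMax hpsd.1 hA0) (quadraticBounds_F hP.objective)
    (singularBounds_lamMinPos_lamMax P.A) hsaddle x₀ hy₀ N

end Regular

section Direct

variable (par : ℝ → ℝ → ℝ → ℝ → APDGParams) (x₀ : Stack m d) (y₀ : Mult m p d) (N : ℕ)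

theorem gradCalls_directProg (P : Problem m d p) :
    (P.directProg par x₀ y₀ N).gradCalls P = N :=
  (congrArg Prod.fst (Prog.cost_apdg P _ _ x₀ y₀ N)).trans (by simp)

theorem commRounds_directProg (P : Problem m d p) :
    (P.directProg par x₀ y₀ N).commRounds P = N * 6 :=
  (congrArg (·.2.1) (Prog.cost_apdg P _ _ x₀ y₀ N)).trans (by simp)

theorem Regular.out_directProg (hP : P.Regular) :
    (P.directProg par x₀ y₀ N).out P =
      apdg P.A P.gradF (P.params par (P.Aᵀ * P.A)) x₀ y₀ N :=
  Prog.out_apdg P _ _ hP.posSemidef_W.1 x₀ y₀ N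

end Direct

theorem Regular.hasComplexity_directProg (hP : P.Regular) {xs : Stack m d}
    (hxs : P.IsSolution xs) {C : ℝ} (hC : 32 ≤ C) (x₀ : Stack m d) {y₀ : Mult m p d}
    (hy₀ : y₀ ∈ P.A.toEuclideanLin.range) :
    P.HasComplexity C
      (max (√(condNum P.W ^ 2 + condNum (P.Bᵀ * P.B)) * √(P.L / P.μ))
        (condNum P.W ^ 2 + condNum (P.Bᵀ * P.B)))
      (C * (P.L / P.μ) * P.initError xs x₀ (P.Aᵀ.toEuclideanLin y₀)) xs
      (fun N => ((P.directProg apdgRule x₀ y₀ N).out P).x) := by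
  have hrate := hP.one_le_rate_A
  rw [← hP.condNum_A_transpose_mul_A, ← P.rate_eq]
  simp only [hP.out_directProg]
  exact hP.hasComplexity_of_exp_decay hxs.1 (by linarith) (by positivity) (by gcongr)
    (hP.norm_apdg_sub_le hxs x₀ hy₀)

/-! ### Chebyshev preconditioning -/

/-- The problem in which `W` is replaced by `P_K(W)` and `B` by `B'`, to be used with a matrix `B'`
such that `B'ᵀB' = P_M(BᵀB)`. -/
noncomputable def precondition (P : Problem m d p) (B' : Matrix (Fin d) (Fin d) ℝ) :
    Problem m d d :=
  ⟨P.G, P.chebW, B', P.f, P.μ, P.L⟩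

namespace Regular

theorem posSemidef_chebW (hP : P.Regular) : P.chebW.PosSemidef :=
  posSemidef_aeval_cheb hP.posSemidef_W hP.W_ne_zero

theorem posSemidef_chebBTB (hP : P.Regular) : P.chebBTB.PosSemidef :=
  posSemidef_aeval_cheb (posSemidef_transpose_mul_self P.B) hP.BTB_ne_zero

theorem chebW_mulVec_eq_zero_iff (hP : P.Regular) (v : Fin m → ℝ) :
    P.chebW *ᵥ v = 0 ↔ P.W *ᵥ v = 0 :=
  aeval_cheb_mulVec_eq_zero_iff hP.posSemidef_W hP.W_ne_zero

theorem condNum_chebW_le (hP : P.Regular) : condNum P.chebW ≤ 4 :=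
  condNum_aeval_cheb_le hP.posSemidef_W hP.W_ne_zero

theorem condNum_chebBTB_le (hP : P.Regular) : condNum P.chebBTB ≤ 4 :=
  condNum_aeval_cheb_le (posSemidef_transpose_mul_self P.B) hP.BTB_ne_zero

theorem natDegree_cheb_W_le (hP : P.Regular) :
    ((cheb P.W).natDegree : ℝ) ≤ √(condNum P.W) :=
  natDegree_cheb_le hP.posSemidef_W hP.W_ne_zero

theorem natDegree_cheb_BTB_le (hP : P.Regular) :
    ((cheb (P.Bᵀ * P.B)).natDegree : ℝ) ≤ √(condNum (P.Bᵀ * P.B)) :=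
  natDegree_cheb_le (posSemidef_transpose_mul_self P.B) hP.BTB_ne_zero

section Precondition

variable {B' : Matrix (Fin d) (Fin d) ℝ}

theorem mulVec_eq_zero_iff_of_eq_chebBTB (hP : P.Regular) (hB' : B'ᵀ * B' = P.chebBTB)
    (x : Fin d → ℝ) : B' *ᵥ x = 0 ↔ P.B *ᵥ x = 0 := by
  rw [← transpose_mul_self_mulVec_eq_zero_iff B', hB', chebBTB,
    aeval_cheb_mulVec_eq_zero_iff (posSemidef_transpose_mul_self P.B) hP.BTB_ne_zero,
    BTB_mulVec_eq_zero_iff]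

theorem precondition (hP : P.Regular) (hB' : B'ᵀ * B' = P.chebBTB) :
    (P.precondition B').Regular where
  posSemidef_W := hP.posSemidef_chebW
  W_ne_zero := aeval_cheb_ne_zero hP.posSemidef_W hP.W_ne_zero
  ker_W := by
    obtain ⟨v, hv, hWv⟩ := hP.ker_W
    exact ⟨v, hv, (hP.chebW_mulVec_eq_zero_iff v).mpr hWv⟩
  B_ne_zero := by
    rintro (rfl : B' = 0)
    rw [Matrix.mul_zero] at hB'
    exact aeval_cheb_ne_zero (posSemidef_transpose_mul_self P.B) hP.BTB_ne_zero hB'.symm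
  ker_B := by
    obtain ⟨x, hx, hBx⟩ := hP.ker_B
    exact ⟨x, hx, (hP.mulVec_eq_zero_iff_of_eq_chebBTB hB' x).mpr hBx⟩
  mu_pos := hP.mu_pos
  objective := hP.objective

theorem feasible_precondition_iff (hP : P.Regular) (hB' : B'ᵀ * B' = P.chebBTB)
    (x : Stack m d) : (P.precondition B').Feasible x ↔ P.Feasible x := by
  simp only [Feasible, Problem.precondition, bigW_toEuclideanLin_eq_zero_iff,
    bigB_toEuclideanLin_eq_zero_iff, hP.chebW_mulVec_eq_zero_iff,
    hP.mulVec_eq_zero_iff_of_eq_chebBTB hB']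

theorem isSolution_precondition (hP : P.Regular) (hB' : B'ᵀ * B' = P.chebBTB)
    {xs : Stack m d} (hxs : P.IsSolution xs) : (P.precondition B').IsSolution xs :=
  ⟨(hP.feasible_precondition_iff hB' xs).mpr hxs.1,
    fun z hz => hxs.2 z ((hP.feasible_precondition_iff hB' z).mp hz)⟩

end Precondition

end Regular

section Precondition

variable {B' : Matrix (Fin d) (Fin d) ℝ}

theorem A_precondition (hB' : B'ᵀ * B' = P.chebBTB) :
    (P.precondition B').A = conMat B' P.chebW P.gammaCheb := by
  rw [A, precondition, hB', gammaCheb]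

namespace Regular

theorem A_precondition_transpose_mul_self (hP : P.Regular) (hB' : B'ᵀ * B' = P.chebBTB) :
    (P.precondition B').Aᵀ * (P.precondition B').A = P.gramCheb := by
  rw [A_precondition hB', conMat_transpose_mul_conMat B' hP.posSemidef_chebW.1, hB', gramCheb]

theorem range_A_precondition_transpose (hP : P.Regular) (hB' : B'ᵀ * B' = P.chebBTB) :
    (P.precondition B').Aᵀ.toEuclideanLin.range = P.Aᵀ.toEuclideanLin.range := by
  have hker : (P.precondition B').A.toEuclideanLin.ker = P.A.toEuclideanLin.ker := by
    ext x
    rw [LinearMap.mem_ker, LinearMap.mem_ker, hP.A_toEuclideanLin_eq_zero_iff,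
      (hP.precondition hB').A_toEuclideanLin_eq_zero_iff, hP.feasible_precondition_iff hB']
  rw [range_transpose_eq_orthogonal_ker, range_transpose_eq_orthogonal_ker, hker]

theorem rate_gramCheb_le (hP : P.Regular) : P.rate P.gramCheb ≤ 20 * √(P.L / P.μ) := by
  obtain ⟨B', hB'⟩ := exists_transpose_mul_self_eq hP.posSemidef_chebBTB
  have hPB' := hP.precondition hB'
  have hχ : condNum P.gramCheb = condNum P.chebW ^ 2 + condNum P.chebBTB := by
    rw [← hP.A_precondition_transpose_mul_self hB', hPB'.condNum_A_transpose_mul_A, ← hB']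
    rfl
  have hχW : 1 ≤ condNum P.chebW := one_le_condNum hPB'.posSemidef_W hPB'.W_ne_zero
  have hχ_le : condNum P.gramCheb ≤ 20 := by
    nlinarith [hP.condNum_chebW_le, hP.condNum_chebBTB_le]
  have hsqrt_le : √(condNum P.gramCheb) ≤ 20 :=
    Real.sqrt_le_iff.mpr ⟨by norm_num, by linarith⟩
  have hsqrt_ratio : 1 ≤ √(P.L / P.μ) := Real.one_le_sqrt.mpr hP.one_le_L_div_mu
  rw [rate_eq]
  exact max_le (by gcongr) (hχ_le.trans (by linarith))

theorem out_chebProg (hP : P.Regular) (hB' : B'ᵀ * B' = P.chebBTB)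
    (par : ℝ → ℝ → ℝ → ℝ → APDGParams) (x₀ : Stack m d) (y₀ : Mult m d d) (N : ℕ) :
    (P.chebProg par x₀ ((P.precondition B').Aᵀ.toEuclideanLin y₀) N).out P =
      (apdg (P.precondition B').A P.gradF (P.params par P.gramCheb) x₀ y₀ N).pullback
        (P.precondition B').A :=
  Prog.out_acc P _ _ _ _ (hP.A_precondition_transpose_mul_self hB') x₀ y₀ N

theorem exists_chebProg_eq_apdg (hP : P.Regular) (par : ℝ → ℝ → ℝ → ℝ → APDGParams)
    (x₀ : Stack m d) {p₀ : Stack m d} (hp₀ : p₀ ∈ P.Aᵀ.toEuclideanLin.range) :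
    ∃ B' : Matrix (Fin d) (Fin d) ℝ, B'ᵀ * B' = P.chebBTB ∧
      (conMat B' P.chebW P.gammaCheb)ᵀ.toEuclideanLin.range = P.Aᵀ.toEuclideanLin.range ∧
      ∃ y₀ ∈ (conMat B' P.chebW P.gammaCheb).toEuclideanLin.range,
        (conMat B' P.chebW P.gammaCheb)ᵀ.toEuclideanLin y₀ = p₀ ∧
        ∀ N, ((P.chebProg par x₀ p₀ N).out P).x =
          (apdg (conMat B' P.chebW P.gammaCheb) P.gradF (P.params par P.gramCheb) x₀ y₀ N).x := by
  obtain ⟨B', hB'⟩ := exists_transpose_mul_self_eq hP.posSemidef_chebBTB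
  have hrange := hP.range_A_precondition_transpose hB'
  obtain ⟨y₀, hy₀, rfl⟩ := exists_mem_range_transpose_eq (P.precondition B').A (hrange ▸ hp₀)
  simp only [hP.out_chebProg hB']
  rw [A_precondition hB'] at hrange hy₀ ⊢
  exact ⟨B', hB', hrange, y₀, hy₀, rfl, fun _ => rfl⟩

theorem hasComplexity_chebProg (hP : P.Regular) {xs : Stack m d} (hxs : P.IsSolution xs)
    {C : ℝ} (hC : 640 ≤ C) (x₀ : Stack m d) {p₀ : Stack m d}
    (hp₀ : p₀ ∈ P.Aᵀ.toEuclideanLin.range) :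
    P.HasComplexity C (√(P.L / P.μ)) (C * (P.L / P.μ) * P.initError xs x₀ p₀) xs
      (fun N => ((P.chebProg apdgRule x₀ p₀ N).out P).x) := by
  obtain ⟨B', hB'⟩ := exists_transpose_mul_self_eq hP.posSemidef_chebBTB
  have hPB' := hP.precondition hB'
  have hgram := hP.A_precondition_transpose_mul_self hB'
  obtain ⟨y₀, hy₀, rfl⟩ := exists_mem_range_transpose_eq (P.precondition B').A
    (hP.range_A_precondition_transpose hB' ▸ hp₀)
  have hrate : 1 ≤ P.rate P.gramCheb := hgram ▸ hPB'.one_le_rate_A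
  have hrate_le : 32 * P.rate P.gramCheb ≤ C * √(P.L / P.μ) :=
    calc 32 * P.rate P.gramCheb ≤ 640 * √(P.L / P.μ) := by linarith [hP.rate_gramCheb_le]
      _ ≤ C * √(P.L / P.μ) := by gcongr
  refine hP.hasComplexity_of_exp_decay hxs.1 (by linarith) (by positivity) hrate_le fun N => ?_
  rw [hP.out_chebProg hB', ← hgram]
  exact hPB'.norm_apdg_sub_le (hP.isSolution_precondition hB' hxs) x₀ hy₀ N

end Regular

end Precondition

section Cost

variable (par : ℝ → ℝ → ℝ → ℝ → APDGParams) (x₀ p₀ : Stack m d) (N : ℕ)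

theorem gradCalls_chebProg (P : Problem m d p) :
    (P.chebProg par x₀ p₀ N).gradCalls P = N :=
  (congrArg Prod.fst (Prog.cost_acc P _ _ _ _ x₀ p₀ N)).trans (by simp)

theorem commRounds_chebProg (P : Problem m d p) :
    (P.chebProg par x₀ p₀ N).commRounds P = N * (6 * (cheb P.W).natDegree) :=
  (congrArg (·.2.1) (Prog.cost_acc P _ _ _ _ x₀ p₀ N)).trans (by simp)

theorem multsB_chebProg (P : Problem m d p) :
    (P.chebProg par x₀ p₀ N).multsB P = N * (6 * (cheb (P.Bᵀ * P.B)).natDegree) :=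
  (congrArg (·.2.2) (Prog.cost_acc P _ _ _ _ x₀ p₀ N)).trans (by simp)

theorem Regular.commRounds_chebProg_le (hP : P.Regular) :
    ((P.chebProg par x₀ p₀ N).commRounds P : ℝ) ≤ 6 * (N * √(condNum P.W)) := by
  rw [commRounds_chebProg]
  push_cast
  linarith [mul_le_mul_of_nonneg_left hP.natDegree_cheb_W_le (Nat.cast_nonneg (α := ℝ) N)]

theorem Regular.multsB_chebProg_le (hP : P.Regular) :
    ((P.chebProg par x₀ p₀ N).multsB P : ℝ) ≤ 6 * (N * √(condNum (P.Bᵀ * P.B))) := by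
  rw [multsB_chebProg]
  push_cast
  linarith [mul_le_mul_of_nonneg_left hP.natDegree_cheb_BTB_le (Nat.cast_nonneg (α := ℝ) N)]

end Cost

end Problem

end DecOpt

theorem mainTheorem2_general :
    ∃ (C : ℝ) (par : ℝ → ℝ → ℝ → ℝ → APDGParams), 0 < C ∧
      (∀ μ L l u : ℝ, 0 < μ → μ ≤ L → 0 < l → l ≤ u → (par μ L l u).Valid) ∧
      ∀ (m d p : ℕ) (P : Problem m d p), P.Regular →
      ∀ xs : Stack m d, P.IsSolution xs →
        (0 < gammaOpt (P.Bᵀ * P.B) P.W ∧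
          IsMinOn (fun γ : ℝ => condNum ((conMat P.B P.W γ)ᵀ * conMat P.B P.W γ)) (Set.Ioi 0)
            (gammaOpt (P.Bᵀ * P.B) P.W) ∧
          condNum (P.Aᵀ * P.A) = condNum P.W ^ 2 + condNum (P.Bᵀ * P.B)) ∧
        (∀ (x₀ : Stack m d) (y₀ : Mult m p d),
          y₀ ∈ P.A.toEuclideanLin.range →
          (∀ N, (P.directProg par x₀ y₀ N).out P =
            apdg P.A P.gradF (P.params par (P.Aᵀ * P.A)) x₀ y₀ N) ∧
          (∀ N, (P.directProg par x₀ y₀ N).gradCalls P = N ∧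
            ((P.directProg par x₀ y₀ N).commRounds P : ℝ) ≤ C * N) ∧
          P.HasComplexity C
            (max (√(condNum P.W ^ 2 + condNum (P.Bᵀ * P.B)) * √(P.L / P.μ))
              (condNum P.W ^ 2 + condNum (P.Bᵀ * P.B)))
            (C * (P.L / P.μ) * P.initError xs x₀ (P.Aᵀ.toEuclideanLin y₀)) xs
            (fun N => ((P.directProg par x₀ y₀ N).out P).x)) ∧
        (((cheb P.W).natDegree : ℝ) ≤ C * √(condNum P.W) ∧
          ((cheb (P.Bᵀ * P.B)).natDegree : ℝ) ≤ C * √(condNum (P.Bᵀ * P.B)) ∧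
          condNum P.chebW ≤ C ∧ condNum P.chebBTB ≤ C) ∧
        (∀ x₀ p₀ : Stack m d, p₀ ∈ P.Aᵀ.toEuclideanLin.range →
          (∃ B' : Matrix (Fin d) (Fin d) ℝ, B'ᵀ * B' = P.chebBTB ∧
            (conMat B' P.chebW P.gammaCheb)ᵀ.toEuclideanLin.range =
              P.Aᵀ.toEuclideanLin.range ∧
            ∃ y₀ ∈ (conMat B' P.chebW P.gammaCheb).toEuclideanLin.range,
              (conMat B' P.chebW P.gammaCheb)ᵀ.toEuclideanLin y₀ = p₀ ∧
              ∀ N, ((P.chebProg par x₀ p₀ N).out P).x =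
                (apdg (conMat B' P.chebW P.gammaCheb) P.gradF (P.params par P.gramCheb)
                  x₀ y₀ N).x) ∧
          (∀ N, (P.chebProg par x₀ p₀ N).gradCalls P = N ∧
            ((P.chebProg par x₀ p₀ N).commRounds P : ℝ) ≤ C * (N * √(condNum P.W)) ∧
            ((P.chebProg par x₀ p₀ N).multsB P : ℝ) ≤ C * (N * √(condNum (P.Bᵀ * P.B)))) ∧
          P.HasComplexity C (√(P.L / P.μ))
            (C * (P.L / P.μ) * P.initError xs x₀ p₀) xs
            (fun N => ((P.chebProg par x₀ p₀ N).out P).x)) := by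
  refine ⟨640, apdgRule, by norm_num, fun _ _ _ _ => apdgRule_valid,
    fun m d p P hP xs hxs => ⟨⟨hP.gammaOpt_pos, hP.isMinOn_condNum, hP.condNum_A_transpose_mul_A⟩,
      fun x₀ y₀ hy₀ => ⟨fun N => hP.out_directProg apdgRule x₀ y₀ N, fun N => ⟨?_, ?_⟩, ?_⟩,
      ⟨?_, ?_, hP.condNum_chebW_le.trans (by norm_num), hP.condNum_chebBTB_le.trans (by norm_num)⟩,
      fun x₀ p₀ hp₀ => ⟨hP.exists_chebProg_eq_apdg apdgRule x₀ hp₀, fun N => ⟨?_, ?_, ?_⟩, ?_⟩⟩⟩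
  · exact P.gradCalls_directProg apdgRule x₀ y₀ N
  · rw [P.commRounds_directProg, Nat.cast_mul, mul_comm]
    gcongr
    norm_num
  · exact hP.hasComplexity_directProg hxs (by norm_num) x₀ hy₀
  · linarith [hP.natDegree_cheb_W_le, Real.sqrt_nonneg (condNum P.W)]
  · linarith [hP.natDegree_cheb_BTB_le, Real.sqrt_nonneg (condNum (P.Bᵀ * P.B))]
  · exact P.gradCalls_chebProg apdgRule x₀ p₀ N
  · exact (hP.commRounds_chebProg_le apdgRule x₀ p₀ N).trans (by gcongr; norm_num)
  · exact (hP.multsB_chebProg_le apdgRule x₀ p₀ N).trans (by gcongr; norm_num)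
  · exact hP.hasComplexity_chebProg hxs le_rfl x₀ hp₀

theorem mainTheorem2 :
    ∃ (C : ℝ) (par : ℝ → ℝ → ℝ → ℝ → APDGParams), 0 < C ∧
      (∀ μ L l u : ℝ, 0 < μ → μ ≤ L → 0 < l → l ≤ u → (par μ L l u).Valid) ∧
      ∀ (m d p : ℕ) (P : Problem m d p), P.Valid →
      ∀ xs : Stack m d, P.IsSolution xs →
        -- the optimal scaling `γ` and the condition number
        (0 < gammaOpt (P.Bᵀ * P.B) P.W ∧
          IsMinOn (fun γ : ℝ => condNum ((conMat P.B P.W γ)ᵀ * conMat P.B P.W γ)) (Set.Ioi 0)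
            (gammaOpt (P.Bᵀ * P.B) P.W) ∧
          condNum (P.Aᵀ * P.A) = condNum P.W ^ 2 + condNum (P.Bᵀ * P.B)) ∧
        -- APDG applied directly
        (∀ (x₀ : Stack m d) (y₀ : Mult m p d),
          x₀ ∈ P.Aᵀ.toEuclideanLin.range → y₀ ∈ P.A.toEuclideanLin.range →
          (∀ N, (P.directProg par x₀ y₀ N).out P =
            apdg P.A P.gradF (P.params par (P.Aᵀ * P.A)) x₀ y₀ N) ∧
          (∀ N, (P.directProg par x₀ y₀ N).gradCalls P = N ∧
            ((P.directProg par x₀ y₀ N).commRounds P : ℝ) ≤ C * N) ∧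
          P.HasComplexity C
            (max (√(condNum P.W ^ 2 + condNum (P.Bᵀ * P.B)) * √(P.L / P.μ))
              (condNum P.W ^ 2 + condNum (P.Bᵀ * P.B)))
            (C * (P.L / P.μ) * P.initError xs x₀ (P.Aᵀ.toEuclideanLin y₀)) xs
            (fun N => ((P.directProg par x₀ y₀ N).out P).x)) ∧
        -- the Chebyshev polynomials
        (((cheb P.W).natDegree : ℝ) ≤ C * √(condNum P.W) ∧
          ((cheb (P.Bᵀ * P.B)).natDegree : ℝ) ≤ C * √(condNum (P.Bᵀ * P.B)) ∧
          condNum P.chebW ≤ C ∧ condNum P.chebBTB ≤ C) ∧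
        -- APDG with Chebyshev acceleration
        (∀ x₀ p₀ : Stack m d,
          x₀ ∈ P.Aᵀ.toEuclideanLin.range → p₀ ∈ P.Aᵀ.toEuclideanLin.range →
          -- it is APDG for the matrix `[I ⊗ B'; γ P_K(W) ⊗ I]` with `B'ᵀB' = P_M(BᵀB)`
          (∃ B' : Matrix (Fin d) (Fin d) ℝ, B'ᵀ * B' = P.chebBTB ∧
            x₀ ∈ (conMat B' P.chebW P.gammaCheb)ᵀ.toEuclideanLin.range ∧
            ∃ y₀ ∈ (conMat B' P.chebW P.gammaCheb).toEuclideanLin.range,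
              (conMat B' P.chebW P.gammaCheb)ᵀ.toEuclideanLin y₀ = p₀ ∧
              ∀ N, ((P.chebProg par x₀ p₀ N).out P).x =
                (apdg (conMat B' P.chebW P.gammaCheb) P.gradF (P.params par P.gramCheb)
                  x₀ y₀ N).x) ∧
          (∀ N, (P.chebProg par x₀ p₀ N).gradCalls P = N ∧
            ((P.chebProg par x₀ p₀ N).commRounds P : ℝ) ≤ C * (N * √(condNum P.W)) ∧
            ((P.chebProg par x₀ p₀ N).multsB P : ℝ) ≤ C * (N * √(condNum (P.Bᵀ * P.B)))) ∧
          P.HasComplexity C (√(P.L / P.μ))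
            (C * (P.L / P.μ) * P.initError xs x₀ p₀) xs
            (fun N => ((P.chebProg par x₀ p₀ N).out P).x)) := by
  obtain ⟨C, par, hC, hpar, h⟩ := mainTheorem2_general
  refine ⟨C, par, hC, hpar, fun m d p P hP xs hxs => ?_⟩
  obtain ⟨hopt, hdirect, hcheb, hacc⟩ := h m d p P hP.regular xs hxs
  refine ⟨hopt, fun x₀ y₀ _ => hdirect x₀ y₀, hcheb, fun x₀ p₀ hx₀ hp₀ => ?_⟩
  obtain ⟨⟨B', hB', hrange, hiterates⟩, hcost⟩ := hacc x₀ p₀ hp₀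
  exact ⟨⟨B', hB', hrange ▸ hx₀, hiterates⟩, hcost⟩
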